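/- **Corollary (FEM accuracy).** Let $\mathcal X=\{0,1\}^d$ (so $d=\log_2|\mathcal X|$), let $n\ge 1$, and let $\mathcal Q$ be a finite nonempty class of statistical queries, each given by a function $q:\mathcal X\to[0,1]$ with $q(D)=\frac1n\sum_{x\in D}q(x)$ for $D\in\mathcal X^n$ and $q(\widehat D)=\mathbb E_{x\sim\widehat D}\,q(x)$ for a distribution $\widehat D$ on $\mathcal X$; assume $\mathcal Q$ is closed under negation $q\mapsto 1-q$. For $\rho>0$, integers $T,s\ge1$ and $\eta>0$, the algorithm FEM does the following on input $D\in\mathcal X^n$. It draws $q_0\in\mathcal Q$ uniformly. In each round $t=1,\dots,T$, (i) the data player draws $s$ independent vectors $\sigma_1,\dots,\sigma_s\in\mathbb R^d$ with i.i.d. $\mathrm{Exp}(\eta)$ coordinates (rate $\eta$), obtains from an exact optimization oracle $x_j^t\in\arg\max_{x\in\mathcal X}\{\sum_{i=0}^{t-1}q_i(x)-\langle x,\sigma_j\rangle\}$, and lets $\widehat D^t$ be the uniform distribution over $x_1^t,\dots,x_s^t$ (with multiplicity); (ii) the query player draws $q_t\in\mathcal Q$ by the exponential mechanism with score $S_t(D,q)=q(D)-q(\widehat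 D^t)$, i.e. with probability proportional to $\exp\big(\sqrt{2\rho/T}\,S_t(D,q)/(2\Delta)\big)$, where $\Delta$ is the sensitivity of $S_t$, the largest change of a score when one entry of the dataset is changed (if $\Delta=0$, $q_t$ is uniform). The output is $\widehat D=\frac1T\sum_{t=1}^T\widehat D^t$. 1. (Privacy) For all $T,s,\eta,\rho$ and all $0<\delta\le1$, FEM is $(\varepsilon,\delta)$-differentially private with $\varepsilon=\rho+2\sqrt{\rho\log(1/\delta)}$, for datasets in $\mathcal X^n$ differing in at most one entry. There are a choice of $T,s,\eta$ depending only on $d,n,|\mathcal Q|,\rho,\beta$ and an absolute integer $c\ge0$ such that the following two bounds hold for every dataset $D\in\mathcal X^n$, every such $\mathcal Q$ and every exact oracle. 2. (Accuracy) There is an absolute constant $C>0$ such that for all $\rho>0$ and $\beta\in(0,1)$, with probability at least $1-\beta$, $$\max_{q\in\mathcal Q}|q(D)-q(\widehat D)|\le C\,\bigl(1+\log(1+n\sqrt\rho)\bigr)^{c}\;\frac{d^{3/4}\sqrt{\log(|\mathcal Q|/\beta)}}{\rho^{1/4}n^{1/2}} .$$ 3. (Accuracy under $(\varepsilon,\delta)$-privacy)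 For every $\kappa\in(0,1)$ there is a constant $C>0$, depending only on $\kappa$, such that for all $\rho>0$ and $\beta,\delta\in(0,\kappa]$ for which $\varepsilon=\rho+2\sqrt{\rho\log(1/\delta)}<1$, with probability at least $1-\beta$, $$\max_{q\in\mathcal Q}|q(D)-q(\widehat D)|\le C\,(1+\log n)^{c}\;\frac{d^{3/4}\log^{1/2}|\mathcal Q|\,\sqrt{\log(1/\delta)\log(1/\beta)}}{\varepsilon^{1/2}n^{1/2}} .$$ -/

import Mathlib

open MeasureTheory ProbabilityTheory

noncomputable section

namespace FEM

/-! ### Data, queries, errors -/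

/-- The data universe `{0,1}^d`; it has `2 ^ d` elements, so `d` is its binary logarithm. -/
abbrev Cube (d : ℕ) : Type := Fin d → Bool

/-- A dataset of `n` records. -/
abbrev Dataset (d n : ℕ) : Type := Fin n → Cube d

/-- Two datasets are neighbours if they differ in at most one entry. -/
def Neighbor {d n : ℕ} (D D' : Dataset d n) : Prop :=
  ∃ i : Fin n, ∀ j : Fin n, j ≠ i → D j = D' j

/-- A finite nonempty class of statistical queries, each given by its predicate
`φ : {0,1}^d → [0,1]`, closed under negation `φ ↦ 1 - φ`. -/
structure QueryClass (d : ℕ) where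
  queries : Finset (Cube d → ℝ)
  nonempty : queries.Nonempty
  mem_Icc : ∀ φ ∈ queries, ∀ x, φ x ∈ Set.Icc (0 : ℝ) 1
  neg_mem : ∀ φ ∈ queries, (fun x => 1 - φ x) ∈ queries

/-- The queries of a class, as a type. -/
abbrev QueryClass.Elem {d : ℕ} (Q : QueryClass d) : Type := {φ // φ ∈ Q.queries}

instance {d : ℕ} (Q : QueryClass d) : Nonempty Q.Elem := Q.nonempty.to_subtype

/-- The size `|Q|` of a query class. -/
def QueryClass.card {d : ℕ} (Q : QueryClass d) : ℕ := Q.queries.card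

/-- The value `q_φ(D)` of the statistical query with predicate `φ` on the dataset `D`. -/
def queryValue {d n : ℕ} (φ : Cube d → ℝ) (D : Dataset d n) : ℝ :=
  (∑ i, φ (D i)) / n

/-- The value of the statistical query on a distribution over the universe, given by its
probability weights `w`: the expectation of `φ`. -/
def queryValueDist {d : ℕ} (φ : Cube d → ℝ) (w : Cube d → ℝ) : ℝ :=
  ∑ x, w x * φ x

/-- The uniform distribution over the records `xs 0, …, xs (s - 1)` (with multiplicity). -/
def empirical {d s : ℕ} (xs : Fin s → Cube d) : Cube d → ℝ :=
  fun x => (∑ j, if xs j = x then (1 : ℝ) else 0) / s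

/-- `max_{q ∈ Q} |q(D) - q(D̂)|` for a synthetic database `D̂` with weights `w`. -/
def maxError {d n : ℕ} (Q : QueryClass d) (D : Dataset d n) (w : Cube d → ℝ) : ℝ :=
  ⨆ φ : Q.Elem, |queryValue φ.1 D - queryValueDist φ.1 w|

/-! ### Differential privacy and the exponential mechanism -/

/-- `(ε, δ)`-differential privacy of a mechanism on datasets of size `n` (whose output laws are
discrete, so that every set of outcomes is measurable). -/
def IsDP {d n : ℕ} {R : Type*} (M : Dataset d n → PMF R) (ε δ : ℝ) : Prop :=
  ∀ D D' : Dataset d n, Neighbor D D' → ∀ S : Set R,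
    (M D).toOuterMeasure S
      ≤ ENNReal.ofReal (Real.exp ε) * (M D').toOuterMeasure S + ENNReal.ofReal δ

/-- The sensitivity `Δ_S` of a score function: the largest change of a score between two
neighbouring datasets. -/
def sensitivity {d n : ℕ} {R : Type*} (S : Dataset d n → R → ℝ) : ℝ :=
  ⨆ p : {p : (Dataset d n × Dataset d n) × R // Neighbor p.1.1 p.1.2},
    |S p.1.1.1 p.1.2 - S p.1.1.2 p.1.2|

/-- The exponential mechanism with score function `S`, finite range `R` and parameter `γ`:
it outputs `r` with probability proportional to `exp (γ * S D r / (2 * Δ_S))`.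
(If `Δ_S = 0` the output is uniform.) -/
def expMechanism {d n : ℕ} {R : Type*} [Fintype R] [Nonempty R]
    (S : Dataset d n → R → ℝ) (γ : ℝ) (D : Dataset d n) : PMF R :=
  PMF.normalize
    (fun r => ENNReal.ofReal (Real.exp (γ * S D r / (2 * sensitivity S))))
    (by
      rw [tsum_fintype]
      intro h
      have h1 := (Finset.sum_eq_zero_iff.mp h) (Classical.arbitrary R) (Finset.mem_univ _)
      have h2 := ENNReal.ofReal_eq_zero.mp h1
      exact absurd (Real.exp_pos _) (not_lt.mpr h2))
    (by
      rw [tsum_fintype]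
      exact (ENNReal.sum_lt_top.mpr fun _ _ => ENNReal.ofReal_lt_top).ne)

/-! ### The data player: follow the perturbed leader -/

/-- The coordinate `x_i ∈ {0,1}` of a record, as a real number. -/
def coord {d : ℕ} (x : Cube d) (i : Fin d) : ℝ := if x i then 1 else 0

/-- The perturbed objective `∑_i q_i(x) - ⟨x, σ⟩`. -/
def objective {d m : ℕ} (qs : Fin m → Cube d → ℝ) (σ : Fin d → ℝ) (x : Cube d) : ℝ :=
  ∑ i, qs i x - ∑ i, coord x i * σ i

/-- An exact optimization oracle: given queries and a perturbation vector it returns some maximizer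
of the perturbed objective (how ties are broken is left to the oracle). -/
structure Oracle (d : ℕ) where
  solve : ∀ {m : ℕ}, (Fin m → Cube d → ℝ) → (Fin d → ℝ) → Cube d
  isMax : ∀ {m : ℕ} (qs : Fin m → Cube d → ℝ) (σ : Fin d → ℝ) (x : Cube d),
    objective qs σ x ≤ objective qs σ (solve qs σ)

/-- The law of a random vector in `ℝ^d` with independent `Exp(η)` coordinates (`η` is the rate,
i.e. each coordinate has density `η * exp (-η * u)` on `u ≥ 0`). -/
def expNoise (d : ℕ) (η : ℝ) : Measure (Fin d → ℝ) :=
  Measure.pi fun _ => expMeasure η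

theorem isProbabilityMeasure_expNoise (d : ℕ) {η : ℝ} (hη : 0 < η) :
    IsProbabilityMeasure (expNoise d η) := by
  have := isProbabilityMeasure_expMeasure hη
  unfold expNoise
  infer_instance

theorem expMeasure_singleton (η u : ℝ) : expMeasure η {u} = 0 := by
  unfold expMeasure gammaMeasure
  exact (withDensity_absolutelyContinuous _ _) (by simp)

/-- A nontrivial affine hyperplane is null for the exponential noise. -/
theorem expNoise_hyperplane {d : ℕ} {η : ℝ} (hη : 0 < η) (a : Fin d → ℝ) (c : ℝ) (i : Fin d)
    (hi : a i ≠ 0) : expNoise d η {σ | ∑ k, a k * σ k = c} = 0 := by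
  have := isProbabilityMeasure_expMeasure hη
  obtain _ | d := d
  · exact i.elim0
  have hmeas : MeasurableSet {σ : Fin (d + 1) → ℝ | ∑ k, a k * σ k = c} :=
    measurableSet_eq_fun (by fun_prop) measurable_const
  have hmp := (measurePreserving_piFinSuccAbove (fun _ : Fin (d + 1) => expMeasure η) i).symm.comp
    (Measure.measurePreserving_swap (μ := Measure.pi fun _ : Fin d => expMeasure η)
      (ν := expMeasure η))
  unfold expNoise
  rw [← hmp.measure_preimage hmeas.nullMeasurableSet,
    Measure.measure_prod_null (hmp.measurable hmeas)]
  refine Filter.Eventually.of_forall fun y => ?_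
  refine measure_mono_null (t := {(c - ∑ k, a (i.succAbove k) * y k) / a i}) (fun u hu => ?_)
    (expMeasure_singleton _ _)
  simp only [Set.mem_preimage, Set.mem_ofPred_eq, Function.comp_apply, Prod.swap_prod_mk,
    MeasurableEquiv.piFinSuccAbove_symm_apply, Fin.insertNthEquiv_apply,
    Fin.sum_univ_succAbove _ i, Fin.insertNth_apply_same, Fin.insertNth_apply_succAbove] at hu
  rw [Set.mem_singleton_iff, eq_div_iff hi]
  linarith

/-- Whatever the tie-breaking rule, the maximizer is an a.e. measurable function of the noise,
since ties have probability zero. -/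
theorem Oracle.aemeasurable_solve {d m : ℕ} (O : Oracle d) {η : ℝ} (hη : 0 < η)
    (qs : Fin m → Cube d → ℝ) : AEMeasurable (fun σ => O.solve qs σ) (expNoise d η) := by
  have htie : ∀ x y : Cube d, x ≠ y →
      expNoise d η {σ | objective qs σ x = objective qs σ y} = 0 := by
    intro x y hxy
    obtain ⟨i, hi⟩ := Function.ne_iff.mp hxy
    have hc : coord x i - coord y i ≠ 0 := by
      unfold coord
      revert hi
      cases x i <;> cases y i <;> simp
    refine measure_mono_null (fun σ hσ => ?_)
      (expNoise_hyperplane hη (fun k => coord x k - coord y k)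
        (∑ k, qs k x - ∑ k, qs k y) i hc)
    simp only [Set.mem_ofPred_eq, objective, sub_mul, Finset.sum_sub_distrib] at hσ ⊢
    linarith
  have hnm : NullMeasurable (fun σ => O.solve qs σ) (expNoise d η) := by
    have hsing : ∀ x : Cube d,
        NullMeasurableSet ((fun σ => O.solve qs σ) ⁻¹' {x}) (expNoise d η) := by
      intro x
      have hM : MeasurableSet {σ : Fin d → ℝ | ∀ y, objective qs σ y ≤ objective qs σ x} := by
        rw [Set.ofPred_forall]
        refine MeasurableSet.iInter fun y => measurableSet_le ?_ ?_ <;>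
          (unfold objective; fun_prop)
      refine hM.nullMeasurableSet.congr ?_
      have hae : ∀ᵐ σ ∂(expNoise d η), ∀ y, y ≠ x → objective qs σ x ≠ objective qs σ y := by
        rw [ae_all_iff]
        intro y
        by_cases hy : y = x
        · simp [hy]
        · have h0 := htie x y (Ne.symm hy)
          filter_upwards [measure_eq_zero_iff_ae_notMem.mp h0] with σ hσ _ using hσ
      filter_upwards [hae] with σ hσ
      refine propext ⟨fun h => ?_, fun h => ?_⟩
      · by_contra hne
        exact hσ _ hne (le_antisymm (O.isMax qs σ x) (h _))
      · have h' : O.solve qs σ = x := h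
        intro y
        rw [← h']
        exact O.isMax qs σ y
    intro S _
    rw [← Set.biUnion_preimage_singleton]
    exact NullMeasurableSet.biUnion S.to_countable fun x _ => hsing x
  exact hnm.aemeasurable

/-- The law of one FTPL sample: the oracle's maximizer for `Exp(η)` noise. -/
def ftplSample {d m : ℕ} (O : Oracle d) (η : Set.Ioi (0 : ℝ)) (qs : Fin m → Cube d → ℝ) :
    PMF (Cube d) :=
  have := isProbabilityMeasure_expNoise d η.2
  have := Measure.isProbabilityMeasure_map (O.aemeasurable_solve η.2 qs)
  ((expNoise d η).map fun σ => O.solve qs σ).toPMF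

/-- The data player's update: `s` independent FTPL samples. -/
def dataPlayer {d m : ℕ} (O : Oracle d) (η : Set.Ioi (0 : ℝ)) (s : ℕ)
    (qs : Fin m → Cube d → ℝ) : PMF (Fin s → Cube d) :=
  (Measure.pi fun _ : Fin s => (ftplSample O η qs).toMeasure).toPMF

/-! ### The algorithm -/

/-- The query player's score function `S_t(D, q) = q(D) - q(D̂^t)`. -/
def score {d n s : ℕ} (Q : QueryClass d) (xs : Fin s → Cube d) (D : Dataset d n) (φ : Q.Elem) : ℝ :=
  queryValue φ.1 D - queryValueDist φ.1 (empirical xs)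

/-- The law of the transcript after `t` rounds: the queries `q_0, …, q_t` and the samples forming
`D̂^1, …, D̂^t`. The parameter `ρ₀` is the privacy budget of a single round. -/
def rounds {d n : ℕ} (O : Oracle d) (Q : QueryClass d) (η : Set.Ioi (0 : ℝ)) (s : ℕ) (ρ₀ : ℝ)
    (D : Dataset d n) : (t : ℕ) → PMF ((Fin (t + 1) → Q.Elem) × (Fin t → Fin s → Cube d))
  | 0 => (PMF.uniformOfFintype Q.Elem).map fun q => (fun _ => q, Fin.elim0)
  | t + 1 =>
      (rounds O Q η s ρ₀ D t).bind fun h =>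
        (dataPlayer O η s fun i => (h.1 i).1).bind fun xs =>
          (expMechanism (score Q xs) (Real.sqrt (2 * ρ₀)) D).map fun q =>
            ((Fin.snoc h.1 q : Fin (t + 2) → Q.Elem),
              (Fin.snoc h.2 xs : Fin (t + 1) → Fin s → Cube d))

/-- The algorithm FEM with `T` rounds, noise parameter `η`, `s` samples per round and target privacy
`ρ`. It outputs (the weights of) the synthetic database `(1/T) ∑_t D̂^t`. -/
def fem {d n : ℕ} (O : Oracle d) (Q : QueryClass d) (ρ : ℝ) (T : ℕ) (η : Set.Ioi (0 : ℝ)) (s : ℕ)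
    (D : Dataset d n) : PMF (Cube d → ℝ) :=
  (rounds O Q η s (ρ / T) D T).map fun h => fun x => (∑ t, empirical (h.2 t) x) / T

end FEM

end

/-! Privacy. Only the exponential mechanism reads the data; given the earlier queries, the data
player's samples are post-processing. For Gibbs laws whose exponents differ by at most `c`,
Hoeffding's lemma bounds the Rényi moment `∑ p^(1+l) q^(-l)` by `exp (l (l+1) c² / 2)`
(`sum_gibbs_rpow_le`). These moments multiply under adaptive composition (`renyiSum_bind_le`), so
`T` rounds of budget `ρ / T` cost at most `exp (l (l+1) ρ)`. A Markov-type argument, with `l`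
optimized, turns this into `(ε, δ)`-privacy.

Accuracy. Let `Φ` be the expected value of the perturbed leader. Adding a query `φ` raises `Φ` by at
most the mean of `φ` under the current leader plus the probability that the leader changes
(`potential_add_le`). With the other noise coordinates fixed, coordinate `i` of the leader is
decided by comparing `σ i` with a threshold that moves by at most 1, and the noise density is at
most `η`; hence the leader changes with probability at most `d η`.

Suppose every round is good: the drawn query maximizes the score up to `a`, and the samples
represent all queries up to `b`. Then each score of round `t` is at most `q_t(D)`, minus the
increment of `Φ`, plus `a + b + d η`. Summing telescopes. Since `∑ q_i(D)` is an average of values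
`∑ q_i(x)`, it is at most `Φ + d / η`, so the averaged scores are at most `(d / η + 1) / T + a + b +
d η` (`maxError_le_of_regretBound`). Closure under negation makes the bound two-sided.

With `N = n √ρ` and `L = log (|Q| / β)`, the choices `η = 1 / √T` and `T ≈ d N / L` balance `d / √T`
against `√T L / N`. The result is `√(d L / N)` up to a logarithm, which is stronger in `d` than the
stated rate. Small `N` and constant queries are handled separately. -/

namespace FEM

/-! ### Rényi moments of discrete laws -/

section Renyi

open scoped ENNReal

/-- The Rényi moment `∑ p^(1+l) q^(-l)` of two discrete laws. -/
noncomputable def renyiSum {A : Type*} (l : ℝ) (p q : PMF A) : ℝ≥0∞ :=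
  ∑' x, p x ^ (1 + l) * q x ^ (-l)

theorem map_apply_of_injective {A B : Type*} {F : A → B} (hF : Function.Injective F) (p : PMF A)
    (a : A) : p.map F (F a) = p a := by
  classical
  rw [PMF.map_apply, tsum_eq_single a]
  · simp
  · intro b hb
    rw [if_neg]
    exact fun h => hb (hF h).symm

theorem map_apply_of_notMem_range {A B : Type*} {F : A → B} (p : PMF A) {b : B}
    (hb : b ∉ Set.range F) : p.map F b = 0 := by
  classical
  rw [PMF.map_apply, ENNReal.tsum_eq_zero]
  intro a
  rw [if_neg]
  exact fun h => hb ⟨a, h.symm⟩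

/-- Off the range of `F` both laws vanish, and such terms contribute nothing since `0 ^ (1 + l) = 0`
and `0 * ⊤ = 0`. -/
theorem renyiSum_map {A B : Type*} {F : A → B} (hF : Function.Injective F) {l : ℝ} (hl : 0 ≤ l)
    (p q : PMF A) : renyiSum l (p.map F) (q.map F) = renyiSum l p q := by
  unfold renyiSum
  rw [← hF.tsum_eq]
  · simp [map_apply_of_injective hF]
  · intro b hb
    by_contra h
    refine hb ?_
    simp only []
    rw [map_apply_of_notMem_range p h, ENNReal.zero_rpow_of_pos (by linarith), zero_mul]

theorem bind_map_mk_apply {A B : Type*} (p : PMF A) (K : A → PMF B) (a : A) (b : B) :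
    (p.bind fun a => (K a).map (Prod.mk a)) (a, b) = p a * K a b := by
  rw [PMF.bind_apply, tsum_eq_single a]
  · rw [map_apply_of_injective (Prod.mk_right_injective a)]
  · intro a' ha
    rw [map_apply_of_notMem_range, mul_zero]
    rintro ⟨b', hb⟩
    exact ha (congrArg Prod.fst hb)

/-- Adaptive composition. Because `a` is kept in the outcome, the joint weights factor as `p a * K a
b`, and the inner sum over `b` is bounded uniformly in `a`. -/
theorem renyiSum_bind_le {A B : Type*} {l : ℝ} (hl : 0 ≤ l) (p q : PMF A) (K K' : A → PMF B)
    {E : ℝ≥0∞} (hE : ∀ a, renyiSum l (K a) (K' a) ≤ E) :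
    renyiSum l (p.bind fun a => (K a).map (Prod.mk a)) (q.bind fun a => (K' a).map (Prod.mk a))
      ≤ renyiSum l p q * E := by
  unfold renyiSum
  rw [ENNReal.tsum_prod', ← ENNReal.tsum_mul_right]
  refine ENNReal.tsum_le_tsum fun a => ?_
  refine le_trans (le_of_eq ?_) (mul_le_mul_right (hE a) _)
  unfold renyiSum
  rw [← ENNReal.tsum_mul_left]
  refine tsum_congr fun b => ?_
  rw [bind_map_mk_apply, bind_map_mk_apply, ENNReal.mul_rpow_of_nonneg _ _ (by linarith),
    ENNReal.mul_rpow_of_ne_top (q.apply_ne_top a) ((K' a).apply_ne_top b)]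
  ring

theorem renyiSum_self {A : Type*} {l : ℝ} (hl : 0 ≤ l) (p : PMF A) : renyiSum l p p = 1 := by
  unfold renyiSum
  rw [← p.tsum_coe]
  refine tsum_congr fun x => ?_
  by_cases hx : p x = 0
  · rw [hx, ENNReal.zero_rpow_of_pos (by linarith), zero_mul]
  · rw [← ENNReal.rpow_add _ _ hx (p.apply_ne_top x)]
    simp

/-- Pointwise Markov: where `p > e^ε q`, the factor `(p / q)^l` is at least `e^(l ε)`, so `p` is at
most `e^(-l ε) p^(1+l) q^(-l)`. -/
theorem toOuterMeasure_le_of_renyiSum_le {A : Type*} {l : ℝ} (hl : 0 ≤ l) (p q : PMF A) (ε : ℝ)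
    {E : ℝ} (hE : renyiSum l p q ≤ ENNReal.ofReal E) (S : Set A) :
    p.toOuterMeasure S ≤ ENNReal.ofReal (Real.exp ε) * q.toOuterMeasure S
      + ENNReal.ofReal (Real.exp (-(l * ε)) * E) := by
  have key : ∀ x, p x ≤ ENNReal.ofReal (Real.exp ε) * q x
      + ENNReal.ofReal (Real.exp (-(l * ε))) * (p x ^ (1 + l) * q x ^ (-l)) := by
    intro x
    by_cases hx : p x ≤ ENNReal.ofReal (Real.exp ε) * q x
    · exact hx.trans le_self_add
    push Not at hx
    have hp : p x ≠ 0 := (bot_le.trans_lt hx).ne'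
    refine le_trans ?_ le_add_self
    have h1 : q x ≤ ENNReal.ofReal (Real.exp (-ε)) * p x := by
      calc q x = ENNReal.ofReal (Real.exp (-ε)) * (ENNReal.ofReal (Real.exp ε) * q x) := by
            rw [← mul_assoc, ← ENNReal.ofReal_mul (Real.exp_pos _).le, ← Real.exp_add]
            simp
        _ ≤ _ := by gcongr
    have h2 : (ENNReal.ofReal (Real.exp (-ε)) * p x) ^ (-l) ≤ q x ^ (-l) := by
      rw [ENNReal.rpow_neg, ENNReal.rpow_neg, ENNReal.inv_le_inv]
      exact ENNReal.rpow_le_rpow h1 hl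
    have h3 : (ENNReal.ofReal (Real.exp (-ε)) * p x) ^ (-l)
        = ENNReal.ofReal (Real.exp (l * ε)) * p x ^ (-l) := by
      rw [ENNReal.mul_rpow_of_ne_top ENNReal.ofReal_ne_top (p.apply_ne_top x),
        ENNReal.ofReal_rpow_of_pos (Real.exp_pos _), ← Real.exp_mul]
      congr 3
      ring
    calc p x = ENNReal.ofReal (Real.exp (-(l * ε))) *
          (p x ^ (1 + l) * (ENNReal.ofReal (Real.exp (l * ε)) * p x ^ (-l))) := by
            rw [show ∀ a b c d : ℝ≥0∞, a * (b * (c * d)) = (a * c) * (b * d) by intros; ring,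
              ← ENNReal.rpow_add _ _ hp (p.apply_ne_top x),
              ← ENNReal.ofReal_mul (Real.exp_pos _).le, ← Real.exp_add]
            simp
      _ ≤ _ := by rw [← h3]; gcongr
  rw [PMF.toOuterMeasure_apply, PMF.toOuterMeasure_apply]
  calc ∑' x, S.indicator p x
      ≤ ∑' x, (ENNReal.ofReal (Real.exp ε) * S.indicator q x
        + ENNReal.ofReal (Real.exp (-(l * ε))) * (p x ^ (1 + l) * q x ^ (-l))) := by
        refine ENNReal.tsum_le_tsum fun x => ?_
        by_cases hx : x ∈ S
        · simpa [hx] using key x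
        · simp [hx]
    _ = ENNReal.ofReal (Real.exp ε) * ∑' x, S.indicator q x
        + ENNReal.ofReal (Real.exp (-(l * ε))) * renyiSum l p q := by
        rw [ENNReal.tsum_add, ENNReal.tsum_mul_left, ENNReal.tsum_mul_left, renyiSum]
    _ ≤ _ := by
        rw [ENNReal.ofReal_mul (Real.exp_pos _).le]
        gcongr

end Renyi

/-! ### The exponential mechanism -/

theorem abs_sub_le_sensitivity {d n : ℕ} {R : Type*} [Finite R] (S : Dataset d n → R → ℝ)
    {D D' : Dataset d n} (h : Neighbor D D') (r : R) : |S D r - S D' r| ≤ sensitivity S :=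
  le_ciSup (f := fun p : {p : (Dataset d n × Dataset d n) × R // Neighbor p.1.1 p.1.2} =>
    |S p.1.1.1 p.1.2 - S p.1.1.2 p.1.2|) (Set.finite_range _).bddAbove ⟨((D, D'), r), h⟩

theorem sensitivity_nonneg {d n : ℕ} {R : Type*} (S : Dataset d n → R → ℝ) : 0 ≤ sensitivity S :=
  Real.iSup_nonneg fun _ => abs_nonneg _

theorem expMechanism_apply {d n : ℕ} {R : Type*} [Fintype R] [Nonempty R]
    (S : Dataset d n → R → ℝ) (γ : ℝ) (D : Dataset d n) (r : R) :
    expMechanism S γ D r = ENNReal.ofReal (Real.exp (γ * S D r / (2 * sensitivity S)) /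
      ∑ r, Real.exp (γ * S D r / (2 * sensitivity S))) := by
  have hpos : 0 < ∑ r, Real.exp (γ * S D r / (2 * sensitivity S)) :=
    Finset.sum_pos (fun _ _ => Real.exp_pos _) Finset.univ_nonempty
  rw [expMechanism, PMF.normalize_apply, tsum_fintype, ENNReal.ofReal_div_of_pos hpos,
    ENNReal.ofReal_sum_of_nonneg fun _ _ => (Real.exp_pos _).le]
  exact (div_eq_mul_inv _ _).symm

/-- Hoeffding's lemma, with `m` the mean of `h`. The value of `m` is irrelevant; what matters is
that one `m` serves every `t`. -/
theorem exists_moment_bound {R : Type*} [Fintype R] (p : R → ℝ) (hp : ∀ r, 0 ≤ p r)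
    (hsum : ∑ r, p r = 1) (h : R → ℝ) {c : ℝ} (hh : ∀ r, |h r| ≤ c) :
    ∃ m : ℝ, ∀ t : ℝ, ∑ r, p r * Real.exp (t * h r) ≤ Real.exp (t * m + c ^ 2 * t ^ 2 / 2) := by
  let _ : MeasurableSpace R := ⊤
  let P : PMF R := PMF.ofFintype (fun r => ENNReal.ofReal (p r))
    (by rw [← ENNReal.ofReal_sum_of_nonneg fun r _ => hp r, hsum, ENNReal.ofReal_one])
  have hP : ∀ r, (P r).toReal = p r := fun r => ENNReal.toReal_ofReal (hp r)
  have hG := hasSubgaussianMGF_of_mem_Icc (μ := P.toMeasure) (X := h) (a := -c) (b := c)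
    (measurable_from_top.aemeasurable) (Filter.Eventually.of_forall fun r => abs_le.mp (hh r))
  refine ⟨P.toMeasure[h], fun t => ?_⟩
  have h1 := hG.mgf_le t
  rw [mgf, PMF.integral_eq_sum] at h1
  have h2 : ((((‖c - -c‖₊ / 2) ^ 2 : NNReal) : ℝ)) = c ^ 2 := by
    push_cast
    rw [Real.norm_eq_abs, div_pow, sq_abs]
    ring
  rw [h2] at h1
  simp only [hP, smul_eq_mul] at h1
  calc ∑ r, p r * Real.exp (t * h r)
      = Real.exp (t * P.toMeasure[h]) *
          ∑ r, p r * Real.exp (t * (h r - P.toMeasure[h])) := by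
        rw [Finset.mul_sum]
        refine Finset.sum_congr rfl fun r _ => ?_
        rw [mul_left_comm, ← Real.exp_add]
        ring_nf
    _ ≤ _ := by
        rw [Real.exp_add]
        gcongr

/-- The sum equals `(W / Z)^l` times the exponential moment of `a - b` at `l`, and `W / Z` is the
same moment at `-1`. Applying the moment bound at both points cancels the unknown mean and leaves
`c² (l + l²) / 2`. -/
theorem sum_gibbs_rpow_le {R : Type*} [Fintype R] [Nonempty R] (a b : R → ℝ) {c l : ℝ}
    (hl : 0 ≤ l) (hab : ∀ r, |a r - b r| ≤ c) :
    ∑ r, (Real.exp (a r) / ∑ r, Real.exp (a r)) ^ (1 + l) *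
      (Real.exp (b r) / ∑ r, Real.exp (b r)) ^ (-l) ≤ Real.exp (l * (l + 1) * c ^ 2 / 2) := by
  have hZ : 0 < ∑ r, Real.exp (a r) :=
    Finset.sum_pos (fun _ _ => Real.exp_pos _) Finset.univ_nonempty
  have hW : 0 < ∑ r, Real.exp (b r) :=
    Finset.sum_pos (fun _ _ => Real.exp_pos _) Finset.univ_nonempty
  set Z := ∑ r, Real.exp (a r)
  set W := ∑ r, Real.exp (b r)
  obtain ⟨m, hm⟩ := exists_moment_bound (fun r => Real.exp (a r) / Z)
    (fun r => (div_pos (Real.exp_pos _) hZ).le)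
    (by rw [← Finset.sum_div]; exact div_self hZ.ne') (fun r => a r - b r) hab
  have h1 := hm l
  have h2 := hm (-1)
  have hWZ : ∑ r, Real.exp (a r) / Z * Real.exp (-1 * (a r - b r)) = W / Z := by
    rw [Finset.sum_div]
    refine Finset.sum_congr rfl fun r _ => ?_
    rw [div_mul_eq_mul_div, ← Real.exp_add]
    ring_nf
  rw [hWZ] at h2
  calc _ = (W / Z) ^ l * ∑ r, Real.exp (a r) / Z * Real.exp (l * (a r - b r)) := by
        rw [Finset.mul_sum]
        refine Finset.sum_congr rfl fun r _ => ?_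
        have hA := Real.exp_pos (a r)
        have hB := Real.exp_pos (b r)
        have hAB : (Real.exp (a r) / Z) ^ l * ((Real.exp (b r) / W) ^ l)⁻¹
            = (W / Z) ^ l * (Real.exp (a r) / Real.exp (b r)) ^ l := by
          rw [← Real.inv_rpow (by positivity), ← Real.mul_rpow (by positivity) (by positivity),
            ← Real.mul_rpow (by positivity) (by positivity)]
          congr 1
          field_simp
        rw [Real.rpow_add (by positivity), Real.rpow_one, Real.rpow_neg (by positivity),
          mul_comm l, Real.exp_mul, Real.exp_sub, mul_assoc, hAB]
        ring
    _ ≤ Real.exp (-1 * m + c ^ 2 * (-1) ^ 2 / 2) ^ l * Real.exp (l * m + c ^ 2 * l ^ 2 / 2) := by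
        gcongr
    _ = _ := by
        rw [← Real.exp_mul, ← Real.exp_add]
        ring_nf

theorem renyiSum_expMechanism_le {d n : ℕ} {R : Type*} [Fintype R] [Nonempty R]
    (S : Dataset d n → R → ℝ) {γ l : ℝ} (hγ : 0 ≤ γ) (hl : 0 ≤ l) {D D' : Dataset d n}
    (h : Neighbor D D') :
    renyiSum l (expMechanism S γ D) (expMechanism S γ D')
      ≤ ENNReal.ofReal (Real.exp (l * (l + 1) * γ ^ 2 / 8)) := by
  have hab : ∀ r, |γ * S D r / (2 * sensitivity S) - γ * S D' r / (2 * sensitivity S)|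
      ≤ γ / 2 := by
    intro r
    have hs := abs_sub_le_sensitivity S h r
    rcases (sensitivity_nonneg S).eq_or_lt with h0 | h0
    -- At zero sensitivity, division by zero makes both exponents `0`, in accordance with the
    -- uniform output.
    · rw [← h0]; simp only [mul_zero, div_zero, sub_self, abs_zero]; positivity
    · rw [← sub_div, ← mul_sub, abs_div, abs_mul, abs_of_nonneg hγ,
        abs_of_pos (by positivity : 0 < 2 * sensitivity S), div_le_div_iff₀ (by positivity) two_pos]
      nlinarith
  refine le_trans ?_ (ENNReal.ofReal_le_ofReal ((sum_gibbs_rpow_le _ _ hl hab).trans_eq ?_))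
  · unfold renyiSum
    rw [tsum_fintype, ENNReal.ofReal_sum_of_nonneg fun r _ => by positivity]
    refine Finset.sum_le_sum fun r _ => le_of_eq ?_
    have hpos : ∀ D, 0 < ∑ r, Real.exp (γ * S D r / (2 * sensitivity S)) := fun D =>
      Finset.sum_pos (fun _ _ => Real.exp_pos _) Finset.univ_nonempty
    rw [expMechanism_apply, expMechanism_apply,
      ENNReal.ofReal_rpow_of_pos (div_pos (Real.exp_pos _) (hpos D)),
      ENNReal.ofReal_rpow_of_pos (div_pos (Real.exp_pos _) (hpos D')),
      ENNReal.ofReal_mul (Real.rpow_nonneg (div_pos (Real.exp_pos _) (hpos D)).le _)]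
  · ring_nf

/-! ### Privacy of the algorithm -/

/-- A round appended to a transcript. -/
def extend {d s t : ℕ} (Q : QueryClass d)
    (p : ((Fin (t + 1) → Q.Elem) × (Fin t → Fin s → Cube d)) × ((Fin s → Cube d) × Q.Elem)) :
    (Fin (t + 2) → Q.Elem) × (Fin (t + 1) → Fin s → Cube d) :=
  ((Fin.snoc p.1.1 p.2.2 : Fin (t + 2) → Q.Elem),
    (Fin.snoc p.1.2 p.2.1 : Fin (t + 1) → Fin s → Cube d))

theorem extend_injective {d s t : ℕ} (Q : QueryClass d) :
    Function.Injective (extend (s := s) (t := t) Q) := by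
  rintro ⟨⟨a, b⟩, x, q⟩ ⟨⟨a', b'⟩, x', q'⟩ h
  simp only [extend, Prod.mk.injEq, Fin.snoc_inj] at h
  simp [h]

/-- The law of the samples and the query of a round, given the queries so far. -/
noncomputable def roundStep {d n m : ℕ} (O : Oracle d) (Q : QueryClass d) (η : Set.Ioi (0 : ℝ))
    (s : ℕ) (ρ₀ : ℝ) (D : Dataset d n) (qs : Fin m → Q.Elem) : PMF ((Fin s → Cube d) × Q.Elem) :=
  (dataPlayer O η s fun i => (qs i).1).bind fun xs =>
    (expMechanism (score Q xs) (Real.sqrt (2 * ρ₀)) D).map (Prod.mk xs)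

theorem rounds_succ {d n : ℕ} (O : Oracle d) (Q : QueryClass d) (η : Set.Ioi (0 : ℝ)) (s : ℕ)
    (ρ₀ : ℝ) (D : Dataset d n) (t : ℕ) :
    rounds O Q η s ρ₀ D (t + 1) = ((rounds O Q η s ρ₀ D t).bind fun h =>
      (roundStep O Q η s ρ₀ D h.1).map (Prod.mk h)).map (extend Q) := by
  simp only [rounds, roundStep, PMF.map_bind, PMF.map_comp]
  rfl

/-- The samples have the same law under both datasets and contribute a factor 1. With `γ² = 2 ρ₀`
the mechanism contributes the exponent `l (l+1) ρ₀ / 4`; the factor 4 is given away. -/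
theorem renyiSum_roundStep_le {d n m : ℕ} (O : Oracle d) (Q : QueryClass d)
    (η : Set.Ioi (0 : ℝ)) (s : ℕ) {ρ₀ l : ℝ} (hρ : 0 ≤ ρ₀) (hl : 0 ≤ l) {D D' : Dataset d n}
    (h : Neighbor D D') (qs : Fin m → Q.Elem) :
    renyiSum l (roundStep O Q η s ρ₀ D qs) (roundStep O Q η s ρ₀ D' qs)
      ≤ ENNReal.ofReal (Real.exp (l * (l + 1) * ρ₀)) := by
  refine (renyiSum_bind_le hl _ _ _ _ fun xs =>
    (renyiSum_expMechanism_le _ (Real.sqrt_nonneg _) hl h)).trans ?_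
  rw [renyiSum_self hl, one_mul, Real.sq_sqrt (by positivity)]
  refine ENNReal.ofReal_le_ofReal (Real.exp_le_exp.mpr ?_)
  have : 0 ≤ l * (l + 1) * ρ₀ := by positivity
  linarith

theorem renyiSum_rounds_le {d n : ℕ} (O : Oracle d) (Q : QueryClass d)
    (η : Set.Ioi (0 : ℝ)) (s : ℕ) {ρ₀ l : ℝ} (hρ : 0 ≤ ρ₀) (hl : 0 ≤ l) {D D' : Dataset d n}
    (h : Neighbor D D') (t : ℕ) :
    renyiSum l (rounds O Q η s ρ₀ D t) (rounds O Q η s ρ₀ D' t)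
      ≤ ENNReal.ofReal (Real.exp (t * (l * (l + 1) * ρ₀))) := by
  induction t with
  | zero =>
    simp only [rounds]
    rw [renyiSum_self hl]
    simp
  | succ t ih =>
    rw [rounds_succ, rounds_succ, renyiSum_map (extend_injective Q) hl]
    have hstep (a : (Fin (t + 1) → Q.Elem) × (Fin t → Fin s → Cube d)) :
        renyiSum l (roundStep O Q η s ρ₀ D a.1) (roundStep O Q η s ρ₀ D' a.1)
          ≤ ENNReal.ofReal (Real.exp (l * (l + 1) * ρ₀)) :=
      renyiSum_roundStep_le O Q η s hρ hl h a.1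
    have hbind := renyiSum_bind_le hl (rounds O Q η s ρ₀ D t) (rounds O Q η s ρ₀ D' t) _ _ hstep
    refine hbind.trans ?_
    calc _ ≤ ENNReal.ofReal (Real.exp (t * (l * (l + 1) * ρ₀)))
          * ENNReal.ofReal (Real.exp (l * (l + 1) * ρ₀)) := mul_le_mul' ih le_rfl
      _ = _ := by
        rw [← ENNReal.ofReal_mul (Real.exp_pos _).le, ← Real.exp_add]
        push_cast
        ring_nf

/-- The order `l = √(L / ρ)`, with `L = log (1 / δ)`, makes the exponent `-l ε + l (l+1) ρ` equal to
`-L`, so the additive term is exactly `δ`. -/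
theorem isDP_fem {d n : ℕ} (O : Oracle d) (Q : QueryClass d) {T : ℕ} (hT : 0 < T) (s : ℕ)
    (η : Set.Ioi (0 : ℝ)) {ρ δ : ℝ} (hρ : 0 < ρ) (hδ : 0 < δ) (hδ1 : δ ≤ 1) :
    IsDP (fem (n := n) O Q ρ T η s) (ρ + 2 * √(ρ * Real.log (1 / δ))) δ := by
  intro D D' h S
  unfold fem
  rw [PMF.toOuterMeasure_map_apply, PMF.toOuterMeasure_map_apply]
  have hT' : (0 : ℝ) < T := by exact_mod_cast hT
  have hL : 0 ≤ Real.log (1 / δ) := Real.log_nonneg (by rw [le_div_iff₀ hδ]; linarith)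
  set L := Real.log (1 / δ)
  have hl : 0 ≤ √(L / ρ) := Real.sqrt_nonneg _
  refine (toOuterMeasure_le_of_renyiSum_le hl _ _ (ρ + 2 * √(ρ * L))
    (renyiSum_rounds_le O Q η s (div_pos hρ hT').le hl h T) _).trans ?_
  gcongr
  rw [← Real.exp_add]
  have h1 : √(L / ρ) * √(ρ * L) = L := by
    rw [← Real.sqrt_mul (by positivity), show L / ρ * (ρ * L) = L * L by field_simp,
      Real.sqrt_mul_self hL]
  have h2 : √(L / ρ) * √(L / ρ) * ρ = L := by
    rw [Real.mul_self_sqrt (by positivity)]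
    field_simp
  calc _ = Real.exp (-L) := by
        congr 1
        have h3 : (T : ℝ) * (√(L / ρ) * (√(L / ρ) + 1) * (ρ / T))
            = √(L / ρ) * √(L / ρ) * ρ + √(L / ρ) * ρ := by
          field_simp
        rw [h3, h2]
        linear_combination (-2) * h1
    _ = δ := by
        rw [← Real.log_inv, one_div, inv_inv, Real.exp_log hδ]
    _ ≤ δ := le_rfl

/-! ### The exponential noise -/

theorem expMeasure_Icc_le {η : ℝ} (hη : 0 < η) (a : ℝ) :
    expMeasure η (Set.Icc a (a + 1)) ≤ ENNReal.ofReal η := by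
  have h : expMeasure η = volume.withDensity (exponentialPDF η) := rfl
  rw [h, withDensity_apply _ measurableSet_Icc]
  calc ∫⁻ x in Set.Icc a (a + 1), exponentialPDF η x
      ≤ ∫⁻ _ in Set.Icc a (a + 1), ENNReal.ofReal η := by
        refine lintegral_mono fun x => ?_
        rw [exponentialPDF_eq]
        refine ENNReal.ofReal_le_ofReal ?_
        split_ifs with hx
        · have : Real.exp (-(η * x)) ≤ 1 := Real.exp_le_one_iff.mpr (by nlinarith)
          nlinarith
        · exact hη.le
    _ = ENNReal.ofReal η := by simp

theorem ae_nonneg_expMeasure (η : ℝ) : ∀ᵐ u ∂(expMeasure η), 0 ≤ u := by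
  have h : expMeasure η = volume.withDensity (exponentialPDF η) := rfl
  rw [ae_iff, h]
  simp only [not_le]
  change (volume.withDensity (exponentialPDF η)) (Set.Iio 0) = 0
  rw [withDensity_apply _ measurableSet_Iio]
  exact lintegral_exponentialPDF_of_nonpos le_rfl

theorem lintegral_id_expMeasure {η : ℝ} (hη : 0 < η) :
    ∫⁻ u, ENNReal.ofReal u ∂(expMeasure η) = ENNReal.ofReal (1 / η) := by
  have h : expMeasure η = volume.withDensity (exponentialPDF η) := rfl
  have hm : Measurable (exponentialPDF η) := (measurable_exponentialPDFReal η).ennreal_ofReal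
  rw [h, lintegral_withDensity_eq_lintegral_mul _ hm (by fun_prop)]
  -- Multiplying the exponential density by `x` gives `1 / η` times the Gamma density of shape 2,
  -- whose total mass is 1.
  calc _ = ∫⁻ x, ENNReal.ofReal (1 / η) * gammaPDF 2 η x := by
        refine lintegral_congr fun x => ?_
        rcases lt_or_ge x 0 with hx | hx
        · rw [gammaPDF_of_neg hx, Pi.mul_apply, exponentialPDF_of_neg hx]
          simp
        · rw [gammaPDF_of_nonneg hx, Pi.mul_apply, exponentialPDF_of_nonneg hx,
            ← ENNReal.ofReal_mul (by positivity), ← ENNReal.ofReal_mul (by positivity)]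
          congr 1
          norm_num [Real.Gamma_two]
          field_simp
    _ = _ := by
        rw [lintegral_const_mul' _ _ ENNReal.ofReal_ne_top,
          lintegral_gammaPDF_eq_one two_pos hη, mul_one]

theorem integrable_id_expMeasure {η : ℝ} (hη : 0 < η) :
    Integrable (fun u : ℝ => u) (expMeasure η) := by
  refine ⟨measurable_id.aestronglyMeasurable, ?_⟩
  rw [hasFiniteIntegral_iff_ofReal (ae_nonneg_expMeasure η), lintegral_id_expMeasure hη]
  exact ENNReal.ofReal_lt_top

theorem integral_id_expMeasure {η : ℝ} (hη : 0 < η) : ∫ u, u ∂(expMeasure η) = 1 / η := by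
  rw [integral_eq_lintegral_of_nonneg_ae (ae_nonneg_expMeasure η)
    measurable_id.aestronglyMeasurable, lintegral_id_expMeasure hη,
    ENNReal.toReal_ofReal (by positivity)]

theorem measurePreserving_eval_expNoise (d : ℕ) {η : ℝ} (hη : 0 < η) (i : Fin d) :
    MeasurePreserving (Function.eval i) (expNoise d η) (expMeasure η) := by
  have := isProbabilityMeasure_expMeasure hη
  exact measurePreserving_eval (fun _ : Fin d => expMeasure η) i

theorem integrable_eval_expNoise (d : ℕ) {η : ℝ} (hη : 0 < η) (i : Fin d) :
    Integrable (fun σ : Fin d → ℝ => σ i) (expNoise d η) :=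
  (measurePreserving_eval_expNoise d hη i).integrable_comp_of_integrable
    (integrable_id_expMeasure hη)

theorem integral_eval_expNoise (d : ℕ) {η : ℝ} (hη : 0 < η) (i : Fin d) :
    ∫ σ, σ i ∂(expNoise d η) = 1 / η := by
  have h := measurePreserving_eval_expNoise d hη i
  rw [← integral_id_expMeasure hη, ← h.map_eq,
    integral_map h.measurable.aemeasurable (f := fun u : ℝ => u)
      measurable_id.aestronglyMeasurable]

theorem ae_nonneg_expNoise (d : ℕ) {η : ℝ} (hη : 0 < η) :
    ∀ᵐ σ ∂(expNoise d η), ∀ i, 0 ≤ σ i := by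
  rw [ae_all_iff]
  intro i
  exact (measurePreserving_eval_expNoise d hη i).quasiMeasurePreserving.ae (ae_nonneg_expMeasure η)

/-- A unit window in one coordinate, placed in dependence on the other coordinates, has mass at
most the rate of the noise. -/
theorem expNoise_window_le {d : ℕ} {η : ℝ} (hη : 0 < η) (i : Fin d) {θ : (Fin d → ℝ) → ℝ}
    (hθ : Measurable θ) (hi : ∀ σ u, θ (Function.update σ i u) = θ σ) :
    expNoise d η {σ | σ i ∈ Set.Icc (θ σ) (θ σ + 1)} ≤ ENNReal.ofReal η := by
  have := isProbabilityMeasure_expMeasure hη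
  obtain _ | d := d
  · exact i.elim0
  have hmeas : MeasurableSet {σ : Fin (d + 1) → ℝ | σ i ∈ Set.Icc (θ σ) (θ σ + 1)} := by
    simp only [Set.mem_Icc]
    exact (measurableSet_le hθ (measurable_pi_apply i)).inter
      (measurableSet_le (measurable_pi_apply i) (hθ.add_const 1))
  have hmp := (measurePreserving_piFinSuccAbove (fun _ : Fin (d + 1) => expMeasure η) i).symm.comp
    (Measure.measurePreserving_swap (μ := Measure.pi fun _ : Fin d => expMeasure η)
      (ν := expMeasure η))
  unfold expNoise
  rw [← hmp.measure_preimage hmeas.nullMeasurableSet,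
    Measure.prod_apply (hmp.measurable hmeas)]
  calc _ ≤ ∫⁻ _, ENNReal.ofReal η ∂(Measure.pi fun _ : Fin d => expMeasure η) := by
        -- With the other coordinates `y` fixed, `θ` is constant in coordinate `i`; inserting `0`
        -- there names that constant.
        refine lintegral_mono fun y => ?_
        refine le_trans (measure_mono (t := Set.Icc (θ (i.insertNth 0 y))
          (θ (i.insertNth 0 y) + 1)) fun u hu => ?_) (expMeasure_Icc_le hη _)
        have hu' : θ (i.insertNth u y) = θ (i.insertNth 0 y) := by
          rw [← Fin.update_insertNth (α := fun _ => ℝ) i 0 u y, hi]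
        have hu2 : (i.insertNth u y : Fin (d + 1) → ℝ) i ∈
          Set.Icc (θ (i.insertNth u y)) (θ (i.insertNth u y) + 1) := hu
        rwa [hu', Fin.insertNth_apply_same] at hu2
    _ = ENNReal.ofReal η := by simp

/-! ### The perturbed leader -/

section Leader

variable {d m : ℕ}

/-- The value of the perturbed leader. -/
noncomputable def leaderValue (qs : Fin m → Cube d → ℝ) (σ : Fin d → ℝ) : ℝ :=
  Finset.univ.sup' Finset.univ_nonempty (objective qs σ)

/-- The expected value of the perturbed leader. -/
noncomputable def potential (η : ℝ) (qs : Fin m → Cube d → ℝ) : ℝ :=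
  ∫ σ, leaderValue qs σ ∂(expNoise d η)

/-- The expectation of a query over an FTPL sample. -/
noncomputable def ftplMean (O : Oracle d) (η : Set.Ioi (0 : ℝ)) (qs : Fin m → Cube d → ℝ)
    (φ : Cube d → ℝ) : ℝ :=
  ∫ x, φ x ∂(ftplSample O η qs).toMeasure

theorem leaderValue_eq (O : Oracle d) (qs : Fin m → Cube d → ℝ) (σ : Fin d → ℝ) :
    leaderValue qs σ = objective qs σ (O.solve qs σ) :=
  le_antisymm (Finset.sup'_le _ _ fun x _ => O.isMax qs σ x)
    (Finset.le_sup' _ (Finset.mem_univ _))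

theorem objective_le_leaderValue (qs : Fin m → Cube d → ℝ) (σ : Fin d → ℝ) (x : Cube d) :
    objective qs σ x ≤ leaderValue qs σ :=
  Finset.le_sup' _ (Finset.mem_univ _)

theorem measurable_univ_sup' {ι α : Type*} [Fintype ι] [Nonempty ι] [MeasurableSpace α]
    {f : ι → α → ℝ} (hf : ∀ i, Measurable (f i)) :
    Measurable fun a => Finset.univ.sup' Finset.univ_nonempty fun i => f i a := by
  convert Finset.measurable_sup' Finset.univ_nonempty (f := f) fun i _ => hf i using 1
  ext a
  rw [Finset.sup'_apply]

theorem measurable_leaderValue (qs : Fin m → Cube d → ℝ) : Measurable (leaderValue qs) :=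
  measurable_univ_sup' (f := fun x σ => objective qs σ x) fun x => by unfold objective; fun_prop

theorem integrable_objective {η : ℝ} (hη : 0 < η) (qs : Fin m → Cube d → ℝ) (x : Cube d) :
    Integrable (fun σ => objective qs σ x) (expNoise d η) := by
  have := isProbabilityMeasure_expNoise d hη
  unfold objective
  exact (integrable_const _).sub
    (integrable_finsetSum _ fun i _ => (integrable_eval_expNoise d hη i).const_mul _)

theorem integrable_leaderValue {η : ℝ} (hη : 0 < η) (qs : Fin m → Cube d → ℝ) :
    Integrable (leaderValue qs) (expNoise d η) := by
  refine Integrable.mono' (g := fun σ => ∑ x, |objective qs σ x|)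
    (integrable_finsetSum _ fun x _ => (integrable_objective hη qs x).abs)
    (measurable_leaderValue qs).aestronglyMeasurable (Filter.Eventually.of_forall fun σ => ?_)
  obtain ⟨x, -, hx⟩ := Finset.exists_mem_eq_sup' Finset.univ_nonempty (objective qs σ)
  rw [leaderValue, hx, Real.norm_eq_abs]
  exact Finset.single_le_sum (f := fun x => |objective qs σ x|) (fun _ _ => abs_nonneg _)
    (Finset.mem_univ x)

theorem coord_mem_Icc (x : Cube d) (i : Fin d) : coord x i ∈ Set.Icc (0 : ℝ) 1 := by
  unfold coord
  split_ifs <;> simp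

/-- The leader dominates the fixed point `x`, whose expected perturbation is at most `d` times the
mean `1 / η`. -/
theorem sum_le_potential_add {η : ℝ} (hη : 0 < η) (qs : Fin m → Cube d → ℝ) (x : Cube d) :
    ∑ i, qs i x ≤ potential η qs + d / η := by
  have := isProbabilityMeasure_expNoise d hη
  have hint : Integrable (fun σ : Fin d → ℝ => ∑ i, coord x i * σ i) (expNoise d η) :=
    integrable_finsetSum _ fun i _ => (integrable_eval_expNoise d hη i).const_mul _
  have h1 : ∫ σ, objective qs σ x ∂(expNoise d η) ≤ potential η qs :=
    integral_mono (integrable_objective hη qs x) (integrable_leaderValue hη qs)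
      fun σ => objective_le_leaderValue qs σ x
  have h2 : ∫ σ, objective qs σ x ∂(expNoise d η) = ∑ i, qs i x - ∑ i, coord x i * (1 / η) := by
    unfold objective
    rw [integral_sub (integrable_const _) hint, integral_finsetSum _ fun i _ =>
      (integrable_eval_expNoise d hη i).const_mul _]
    simp [integral_const_mul, integral_eval_expNoise d hη]
  have h3 : ∑ i, coord x i * (1 / η) ≤ d / η := by
    calc ∑ i, coord x i * (1 / η) ≤ ∑ _i : Fin d, 1 * (1 / η) := by
          gcongr with i
          exact (coord_mem_Icc x i).2
      _ = d / η := by simp [div_eq_mul_inv]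
  linarith

/-- Coordinates and noise are nonnegative, so the perturbation only lowers the objective. -/
theorem potential_le {η : ℝ} (hη : 0 < η) (qs : Fin m → Cube d → ℝ)
    (hqs : ∀ i x, qs i x ≤ 1) : potential η qs ≤ m := by
  have := isProbabilityMeasure_expNoise d hη
  calc potential η qs ≤ ∫ _, (m : ℝ) ∂(expNoise d η) := by
        refine integral_mono_ae (integrable_leaderValue hη qs) (integrable_const _) ?_
        filter_upwards [ae_nonneg_expNoise d hη] with σ hσ
        refine Finset.sup'_le _ _ fun x _ => ?_
        have h1 : ∑ i, qs i x ≤ ∑ _i : Fin m, (1 : ℝ) := Finset.sum_le_sum fun i _ => hqs i x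
        have h2 : 0 ≤ ∑ i, coord x i * σ i :=
          Finset.sum_nonneg fun i _ => mul_nonneg (coord_mem_Icc x i).1 (hσ i)
        simp only [Finset.sum_const, Finset.card_univ, Fintype.card_fin, nsmul_eq_mul,
          mul_one] at h1
        unfold objective
        linarith
    _ = m := by simp

/-! ### Stability of the perturbed leader -/

/-- The best perturbed objective among points with `i`-th coordinate `b`, ignoring the noise in
coordinate `i`. -/
noncomputable def faceValue (qs : Fin m → Cube d → ℝ) (i : Fin d) (b : Bool) (σ : Fin d → ℝ) : ℝ :=
  Finset.univ.sup' Finset.univ_nonempty fun x : Cube d =>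
    objective qs (Function.update σ i 0) (Function.update x i b)

/-- The threshold at which the noise in coordinate `i` flips that coordinate of the leader. -/
noncomputable def threshold (qs : Fin m → Cube d → ℝ) (i : Fin d) (σ : Fin d → ℝ) : ℝ :=
  faceValue qs i true σ - faceValue qs i false σ

theorem measurable_threshold (qs : Fin m → Cube d → ℝ) (i : Fin d) :
    Measurable (threshold qs i) := by
  have h : ∀ b, Measurable (faceValue qs i b) := fun b =>
    measurable_univ_sup' (f := fun (x : Cube d) σ =>
      objective qs (Function.update σ i 0) (Function.update x i b)) fun x => by
      have hu : Measurable fun σ : Fin d → ℝ => Function.update σ i 0 := by fun_prop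
      have ho : Measurable fun σ : Fin d → ℝ => objective qs σ (Function.update x i b) := by
        unfold objective; fun_prop
      exact ho.comp hu
  exact (h true).sub (h false)

theorem threshold_update (qs : Fin m → Cube d → ℝ) (i : Fin d) (σ : Fin d → ℝ) (u : ℝ) :
    threshold qs i (Function.update σ i u) = threshold qs i σ := by
  simp [threshold, faceValue]

theorem objective_update_zero (qs : Fin m → Cube d → ℝ) (i : Fin d) (σ : Fin d → ℝ) (x : Cube d) :
    objective qs σ x = objective qs (Function.update σ i 0) x - coord x i * σ i := by
  have h : ∑ k, coord x k * σ k
      = ∑ k, coord x k * Function.update σ i 0 k + coord x i * σ i := by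
    rw [← Finset.add_sum_erase _ _ (Finset.mem_univ i),
      ← Finset.add_sum_erase (a := i) _ (fun k => coord x k * Function.update σ i 0 k)
        (Finset.mem_univ i)]
    rw [Finset.sum_congr rfl fun k hk => by
      rw [← Function.update_of_ne (Finset.ne_of_mem_erase hk) 0 σ]]
    simp
    ring
  unfold objective
  linarith

theorem faceValue_sub_le_leaderValue (qs : Fin m → Cube d → ℝ) (i : Fin d) (σ : Fin d → ℝ) (b : Bool) :
    faceValue qs i b σ - (if b then σ i else 0) ≤ leaderValue qs σ := by
  obtain ⟨x, -, hx⟩ := Finset.exists_mem_eq_sup' Finset.univ_nonempty fun x : Cube d =>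
    objective qs (Function.update σ i 0) (Function.update x i b)
  have h := objective_le_leaderValue qs σ (Function.update x i b)
  rw [objective_update_zero qs i] at h
  rw [faceValue, hx]
  cases b <;> simpa [coord] using h

theorem objective_le_faceValue (qs : Fin m → Cube d → ℝ) (i : Fin d) (σ : Fin d → ℝ) (x : Cube d) :
    objective qs σ x ≤ faceValue qs i (x i) σ - (if x i then σ i else 0) := by
  rw [objective_update_zero qs i]
  have h := Finset.le_sup' (fun y : Cube d =>
    objective qs (Function.update σ i 0) (Function.update y i (x i))) (Finset.mem_univ x)
  simp only [Function.update_eq_self] at h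
  have h2 : coord x i * σ i = if x i then σ i else 0 := by simp [coord]
  rw [h2]
  exact sub_le_sub_right h _

/-- The leader lies on the face `x i = true`, so the value of that face minus `σ i` is at least the
value of the opposite face. Ties are harmless because the inequality is not strict. -/
theorem solve_true_le_threshold (O : Oracle d) (qs : Fin m → Cube d → ℝ) {i : Fin d}
    {σ : Fin d → ℝ} (h : O.solve qs σ i = true) : σ i ≤ threshold qs i σ := by
  have h1 := faceValue_sub_le_leaderValue qs i σ false
  have h2 := objective_le_faceValue qs i σ (O.solve qs σ)
  rw [← leaderValue_eq, h] at h2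
  simp only [Bool.false_eq_true, if_false, if_true] at h1 h2
  unfold threshold
  linarith

theorem threshold_le_of_solve_false (O : Oracle d) (qs : Fin m → Cube d → ℝ) {i : Fin d}
    {σ : Fin d → ℝ} (h : O.solve qs σ i = false) : threshold qs i σ ≤ σ i := by
  have h1 := faceValue_sub_le_leaderValue qs i σ true
  have h2 := objective_le_faceValue qs i σ (O.solve qs σ)
  rw [← leaderValue_eq, h] at h2
  simp only [Bool.false_eq_true, if_false, if_true] at h1 h2
  unfold threshold
  linarith

variable {m' : ℕ} {qs : Fin m → Cube d → ℝ} {qs' : Fin m' → Cube d → ℝ} {φ : Cube d → ℝ}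

theorem objective_add (hqs : ∀ x, ∑ i, qs' i x = ∑ i, qs i x + φ x) (σ : Fin d → ℝ) (x : Cube d) :
    objective qs' σ x = objective qs σ x + φ x := by
  unfold objective
  rw [hqs]
  ring

theorem faceValue_mem_Icc_of_add (hqs : ∀ x, ∑ i, qs' i x = ∑ i, qs i x + φ x)
    (hφ : ∀ x, φ x ∈ Set.Icc (0 : ℝ) 1) (i : Fin d) (b : Bool) (σ : Fin d → ℝ) :
    faceValue qs' i b σ ∈ Set.Icc (faceValue qs i b σ) (faceValue qs i b σ + 1) := by
  constructor
  · refine Finset.sup'_mono_fun fun x _ => ?_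
    rw [objective_add hqs]
    linarith [(hφ (Function.update x i b)).1]
  · refine Finset.sup'_le _ _ fun x _ => ?_
    rw [objective_add hqs]
    have h := Finset.le_sup' (fun y : Cube d =>
      objective qs (Function.update σ i 0) (Function.update y i b)) (Finset.mem_univ x)
    exact add_le_add h (hφ _).2

/-- Adding a query changes a coordinate of the leader only if the noise in that coordinate lies in a
unit window. -/
theorem mem_window_of_solve_ne (O : Oracle d) (hqs : ∀ x, ∑ i, qs' i x = ∑ i, qs i x + φ x)
    (hφ : ∀ x, φ x ∈ Set.Icc (0 : ℝ) 1) {i : Fin d} {σ : Fin d → ℝ}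
    (hne : O.solve qs σ i ≠ O.solve qs' σ i) :
    σ i ∈ Set.Icc (min (threshold qs i σ) (threshold qs' i σ))
      (min (threshold qs i σ) (threshold qs' i σ) + 1) := by
  -- Each face value increases by an amount in `[0, 1]`, so their difference, the threshold, moves
  -- by at most 1 in either direction.
  have ht := faceValue_mem_Icc_of_add hqs hφ i true σ
  have hf := faceValue_mem_Icc_of_add hqs hφ i false σ
  have h1 : threshold qs' i σ ≤ threshold qs i σ + 1 := by
    unfold threshold; linarith [ht.2, hf.1]
  have h2 : threshold qs i σ ≤ threshold qs' i σ + 1 := by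
    unfold threshold; linarith [ht.1, hf.2]
  rw [Set.mem_Icc, min_le_iff, ← min_add_add_right, le_min_iff]
  cases h : O.solve qs σ i <;> cases h' : O.solve qs' σ i
  · exact absurd (h.trans h'.symm) hne
  · have := threshold_le_of_solve_false O qs h
    have := solve_true_le_threshold O qs' h'
    exact ⟨Or.inl (by assumption), by linarith, by linarith⟩
  · have := threshold_le_of_solve_false O qs' h'
    have := solve_true_le_threshold O qs h
    exact ⟨Or.inr (by assumption), by linarith, by linarith⟩
  · exact absurd (h.trans h'.symm) hne

theorem ftplSample_toMeasure (O : Oracle d) (η : Set.Ioi (0 : ℝ)) (qs : Fin m → Cube d → ℝ) :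
    (ftplSample O η qs).toMeasure = (expNoise d η).map fun σ => O.solve qs σ := by
  unfold ftplSample
  have := isProbabilityMeasure_expNoise d η.2
  have := Measure.isProbabilityMeasure_map (O.aemeasurable_solve η.2 qs)
  exact Measure.toPMF_toMeasure _

theorem ftplMean_eq (O : Oracle d) (η : Set.Ioi (0 : ℝ)) (qs : Fin m → Cube d → ℝ)
    (φ : Cube d → ℝ) : ftplMean O η qs φ = ∫ σ, φ (O.solve qs σ) ∂(expNoise d η) := by
  rw [ftplMean, ftplSample_toMeasure, integral_map (O.aemeasurable_solve η.2 qs)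
    (measurable_of_finite φ).aestronglyMeasurable]

/-- Both leaders are run on the same noise. The new leader `x'` satisfies `leaderValue qs' ≤
leaderValue qs + φ x'`, and `φ x'` may be replaced by `φ` at the old leader at a cost of at most 1,
paid only when the leaders differ. A union bound over coordinates bounds this event by `d η`. -/
theorem potential_add_le (O : Oracle d) (η : Set.Ioi (0 : ℝ))
    (hqs : ∀ x, ∑ i, qs' i x = ∑ i, qs i x + φ x) (hφ : ∀ x, φ x ∈ Set.Icc (0 : ℝ) 1) :
    potential η qs' ≤ potential η qs + ftplMean O η qs φ + d * η := by
  have := isProbabilityMeasure_expNoise d η.2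
  set θ : Fin d → (Fin d → ℝ) → ℝ := fun i σ => min (threshold qs i σ) (threshold qs' i σ)
  set E : Fin d → Set (Fin d → ℝ) := fun i => {σ | σ i ∈ Set.Icc (θ i σ) (θ i σ + 1)}
  have hθ : ∀ i, Measurable (θ i) := fun i =>
    (measurable_threshold qs i).min (measurable_threshold qs' i)
  have hE : ∀ i, MeasurableSet (E i) := fun i =>
    (measurableSet_le (hθ i) (by fun_prop)).inter
      (measurableSet_le (by fun_prop) ((hθ i).add_const 1))
  have hEη : ∀ i, (expNoise d η).real (E i) ≤ η := fun i =>
    ENNReal.toReal_le_of_le_ofReal (le_of_lt η.2)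
      (expNoise_window_le η.2 i (hθ i) fun σ u => by simp only [θ, threshold_update])
  have hint : Integrable (fun σ => φ (O.solve qs σ)) (expNoise d η) :=
    Integrable.of_mem_Icc 0 1 ((measurable_of_finite φ).comp_aemeasurable
      (O.aemeasurable_solve η.2 qs)) (Filter.Eventually.of_forall fun σ => hφ _)
  have hintE : ∀ i ∈ Finset.univ, Integrable ((E i).indicator fun _ => (1 : ℝ)) (expNoise d η) :=
    fun i _ => (integrable_const _).indicator (hE i)
  have hpt : ∀ σ, leaderValue qs' σ ≤ leaderValue qs σ + φ (O.solve qs σ)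
      + ∑ i, (E i).indicator (fun _ => (1 : ℝ)) σ := by
    intro σ
    have h0 : ∀ i ∈ Finset.univ, 0 ≤ (E i).indicator (fun _ => (1 : ℝ)) σ := fun i _ =>
      Set.indicator_nonneg (fun _ _ => zero_le_one) _
    have h1 := objective_le_leaderValue qs σ (O.solve qs' σ)
    rw [leaderValue_eq O qs', objective_add hqs]
    by_cases h : O.solve qs σ = O.solve qs' σ
    · rw [h]
      linarith [Finset.sum_nonneg h0]
    · obtain ⟨i, hi⟩ := Function.ne_iff.mp h
      have h2 := Finset.single_le_sum h0 (Finset.mem_univ i)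
      rw [Set.indicator_of_mem (show σ ∈ E i from mem_window_of_solve_ne O hqs hφ hi)] at h2
      linarith [(hφ (O.solve qs' σ)).2, (hφ (O.solve qs σ)).1]
  calc potential η qs' ≤ ∫ σ, (leaderValue qs σ + φ (O.solve qs σ)
      + ∑ i, (E i).indicator (fun _ => (1 : ℝ)) σ) ∂(expNoise d η) :=
        integral_mono (integrable_leaderValue η.2 qs')
          (((integrable_leaderValue η.2 qs).add hint).add (integrable_finsetSum _ hintE)) hpt
    _ = potential η qs + ftplMean O η qs φ + ∑ i, (expNoise d η).real (E i) := by
        rw [integral_add (f := fun σ => leaderValue qs σ + φ (O.solve qs σ))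
          ((integrable_leaderValue η.2 qs).add hint)
          (integrable_finsetSum _ hintE), integral_add (integrable_leaderValue η.2 qs) hint,
          integral_finsetSum _ hintE, ftplMean_eq, potential]
        congr 1
        refine Finset.sum_congr rfl fun i _ => ?_
        rw [integral_indicator_const _ (hE i), smul_eq_mul, mul_one]
    _ ≤ _ := by
        have : ∑ i, (expNoise d η).real (E i) ≤ ∑ _i : Fin d, (η : ℝ) :=
          Finset.sum_le_sum fun i _ => hEη i
        simp only [Finset.sum_const, Finset.card_univ, Fintype.card_fin, nsmul_eq_mul] at this
        linarith

end Leader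

/-! ### Failure probability of a round -/

/-- Union bound along a `bind`: either the first stage lands in `E`, or the second fails with
conditional probability at most `c`. -/
theorem toOuterMeasure_bind_le {A B : Type*} (p : PMF A) (f : A → PMF B) (S : Set B) (E : Set A)
    {c : ENNReal} (hc : ∀ a, a ∉ E → (f a).toOuterMeasure S ≤ c) :
    (p.bind f).toOuterMeasure S ≤ p.toOuterMeasure E + c := by
  rw [PMF.toOuterMeasure_bind_apply, PMF.toOuterMeasure_apply]
  calc ∑' a, p a * (f a).toOuterMeasure S ≤ ∑' a, (E.indicator p a + p a * c) := by
        refine ENNReal.tsum_le_tsum fun a => ?_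
        by_cases ha : a ∈ E
        · rw [Set.indicator_of_mem ha]
          refine le_trans ?_ le_self_add
          calc p a * (f a).toOuterMeasure S ≤ p a * 1 := by
                gcongr
                rw [← (PMF.toOuterMeasure_apply_eq_one_iff (f a) _).mpr (Set.subset_univ _)]
                exact measure_mono (Set.subset_univ _)
            _ = p a := mul_one _
        · rw [Set.indicator_of_notMem ha, zero_add]
          gcongr
          exact hc a ha
    _ = _ := by rw [ENNReal.tsum_add, ENNReal.tsum_mul_right, p.tsum_coe, one_mul]

/-- Bounding the normalizer below by the term of a better `r'` gives each bad `r` probability at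
most `exp (-γ a / (2Δ))`; there are at most `|R|` of them. -/
theorem expMechanism_tail {d n : ℕ} {R : Type*} [Fintype R] [Nonempty R]
    (S : Dataset d n → R → ℝ) {γ : ℝ} (hγ : 0 ≤ γ) (D : Dataset d n) (hS : 0 < sensitivity S)
    (a : ℝ) :
    (expMechanism S γ D).toOuterMeasure {r | ∃ r', S D r + a < S D r'}
      ≤ ENNReal.ofReal (Fintype.card R * Real.exp (-(γ * a / (2 * sensitivity S)))) := by
  classical
  rw [PMF.toOuterMeasure_apply_fintype, ENNReal.ofReal_mul (by positivity),
    ENNReal.ofReal_natCast, ← nsmul_eq_mul]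
  refine Finset.sum_le_card_nsmul _ _ _ fun r _ => ?_
  by_cases hr : r ∈ {r | ∃ r', S D r + a < S D r'}
  · rw [Set.indicator_of_mem hr, expMechanism_apply]
    obtain ⟨r', hr'⟩ := hr
    refine ENNReal.ofReal_le_ofReal ?_
    have h1 : Real.exp (γ * S D r' / (2 * sensitivity S))
        ≤ ∑ r, Real.exp (γ * S D r / (2 * sensitivity S)) :=
      Finset.single_le_sum (f := fun r => Real.exp (γ * S D r / (2 * sensitivity S)))
        (fun _ _ => (Real.exp_pos _).le) (Finset.mem_univ r')
    rw [div_le_iff₀ (lt_of_lt_of_le (Real.exp_pos _) h1)]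
    refine le_trans ?_ (mul_le_mul_of_nonneg_left h1 (Real.exp_pos _).le)
    rw [← Real.exp_add, Real.exp_le_exp, ← neg_div, ← add_div]
    gcongr
    nlinarith
  · rw [Set.indicator_of_notMem hr]
    exact zero_le

theorem queryValueDist_empirical {d s : ℕ} (φ : Cube d → ℝ) (xs : Fin s → Cube d) :
    queryValueDist φ (empirical xs) = (∑ j, φ (xs j)) / s := by
  unfold queryValueDist empirical
  simp only [div_mul_eq_mul_div, ← Finset.sum_div, Finset.sum_mul]
  rw [Finset.sum_comm]
  simp

theorem queryValueDist_const_empirical {d s : ℕ} (hs : 0 < s) {φ : Cube d → ℝ} {k : ℝ}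
    (hφ : ∀ x, φ x = k) (xs : Fin s → Cube d) : queryValueDist φ (empirical xs) = k := by
  have : (s : ℝ) ≠ 0 := by exact_mod_cast hs.ne'
  rw [queryValueDist_empirical]
  simp [hφ]
  field_simp

theorem queryValue_const {d n : ℕ} (hn : 0 < n) {φ : Cube d → ℝ} {k : ℝ}
    (hφ : ∀ x, φ x = k) (D : Dataset d n) : queryValue φ D = k := by
  have : (n : ℝ) ≠ 0 := by exact_mod_cast hn.ne'
  simp [queryValue, hφ]
  field_simp

theorem queryValue_sub_of_neighbor {d n : ℕ} (φ : Cube d → ℝ) {D D' : Dataset d n} {i : Fin n}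
    (h : ∀ j, j ≠ i → D j = D' j) :
    queryValue φ D - queryValue φ D' = (φ (D i) - φ (D' i)) / n := by
  unfold queryValue
  rw [← sub_div, ← Finset.sum_sub_distrib, Finset.sum_eq_single i]
  · intro j _ hj
    rw [h j hj, sub_self]
  · simp

section Accuracy

variable {d n s : ℕ} {Q : QueryClass d}

theorem sensitivity_score_le (hn : 0 < n) (xs : Fin s → Cube d) :
    sensitivity (score (n := n) Q xs) ≤ 1 / n := by
  refine Real.iSup_le ?_ (by positivity)
  rintro ⟨⟨⟨D, D'⟩, φ⟩, i, hi⟩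
  simp only [score, sub_sub_sub_cancel_right]
  rw [queryValue_sub_of_neighbor φ.1 hi, abs_div, Nat.abs_cast]
  gcongr
  have h1 := Q.mem_Icc φ.1 φ.2 (D i)
  have h2 := Q.mem_Icc φ.1 φ.2 (D' i)
  rw [abs_le]
  constructor <;> linarith [h1.1, h1.2, h2.1, h2.2]

/-- Changing a single record would reveal any variation of `φ`, so zero sensitivity forces every
query to be constant. The uniform draw then loses nothing. -/
theorem score_eq_zero (hn : 0 < n) (hs : 0 < s) (xs : Fin s → Cube d)
    (h0 : sensitivity (score (n := n) Q xs) = 0) (D : Dataset d n) (φ : Q.Elem) :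
    score Q xs D φ = 0 := by
  have hconst : ∀ x, φ.1 x = φ.1 fun _ => false := by
    intro x
    let i : Fin n := ⟨0, hn⟩
    have hi : ∀ j, j ≠ i → (Function.update (fun _ => fun _ => false) i x : Dataset d n) j
        = (fun _ => fun _ => false : Dataset d n) j := fun j hj => Function.update_of_ne hj _ _
    have h := abs_sub_le_sensitivity (score (n := n) Q xs) ⟨i, hi⟩ φ
    rw [h0] at h
    have h1 := abs_nonpos_iff.mp h
    simp only [score, sub_sub_sub_cancel_right] at h1
    rw [queryValue_sub_of_neighbor φ.1 hi, div_eq_zero_iff] at h1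
    have hn' : (n : ℝ) ≠ 0 := by exact_mod_cast hn.ne'
    have h2 := h1.resolve_right hn'
    rw [Function.update_self] at h2
    linarith
  rw [score, queryValue_const hn hconst, queryValueDist_const_empirical hs hconst, sub_self]

theorem expMechanism_score_tail (hn : 0 < n) (hs : 0 < s) (xs : Fin s → Cube d) {γ a : ℝ}
    (hγ : 0 ≤ γ) (ha : 0 ≤ a) (D : Dataset d n) :
    (expMechanism (score Q xs) γ D).toOuterMeasure
        {q | ∃ φ, score Q xs D q + a < score Q xs D φ}
      ≤ ENNReal.ofReal (Q.card * Real.exp (-(γ * a * n / 2))) := by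
  rcases (sensitivity_nonneg (score (n := n) Q xs)).eq_or_lt with h0 | h0
  · have hz := score_eq_zero hn hs xs h0.symm D
    have : {q | ∃ φ, score Q xs D q + a < score Q xs D φ} = ∅ := by
      ext q
      simp [hz, ha]
    rw [this]
    simp
  · refine (expMechanism_tail _ hγ D h0 a).trans (ENNReal.ofReal_le_ofReal ?_)
    have hcard : Fintype.card Q.Elem = Q.card := Fintype.card_coe _
    rw [hcard]
    gcongr ?_ * Real.exp (-?_)
    have h1 := sensitivity_score_le (Q := Q) hn xs
    have hn' : (0 : ℝ) < n := by exact_mod_cast hn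
    rw [le_div_iff₀ hn'] at h1
    rw [div_le_div_iff₀ two_pos (by positivity)]
    have h2 : 0 ≤ γ * a := by positivity
    nlinarith

/-- Hoeffding's inequality for `s` independent variables of range 1. The sign is flipped because the
upper-tail bound is applied to a lower deviation of the empirical mean. -/
theorem dataPlayer_tail {m : ℕ} (O : Oracle d) (η : Set.Ioi (0 : ℝ)) (hs : 0 < s)
    (qs : Fin m → Cube d → ℝ) {φ : Cube d → ℝ} (hφ : ∀ x, φ x ∈ Set.Icc (0 : ℝ) 1) {b : ℝ}
    (hb : 0 ≤ b) :
    (dataPlayer O η s qs).toOuterMeasure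
        {xs | queryValueDist φ (empirical xs) + b ≤ ftplMean O η qs φ}
      ≤ ENNReal.ofReal (Real.exp (-(2 * s * b ^ 2))) := by
  set μ := (ftplSample O η qs).toMeasure
  have hs' : (0 : ℝ) < s := by exact_mod_cast hs
  have hφm : Measurable φ := measurable_of_finite φ
  rw [← PMF.toMeasure_apply_eq_toOuterMeasure, dataPlayer, Measure.toPMF_toMeasure]
  have hmean : ∀ j : Fin s, ∫ ω, -φ (ω j) ∂(Measure.pi fun _ : Fin s => μ)
      = -ftplMean O η qs φ := by
    intro j
    have hmp := measurePreserving_eval (fun _ : Fin s => μ) j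
    rw [integral_neg, ftplMean]
    congr 1
    calc _ = ∫ x, φ x ∂(Measure.map (Function.eval j) (Measure.pi fun _ : Fin s => μ)) :=
          (integral_map hmp.measurable.aemeasurable hφm.aestronglyMeasurable).symm
      _ = _ := by rw [hmp.map_eq]
  have hind : iIndepFun (fun (j : Fin s) (ω : Fin s → Cube d) =>
      -φ (ω j) - -ftplMean O η qs φ) (Measure.pi fun _ : Fin s => μ) :=
    iIndepFun_pi (X := fun _ x => -φ x - -ftplMean O η qs φ)
      fun _ => (hφm.neg.sub_const _).aemeasurable
  have hsub : ∀ j ∈ (Finset.univ : Finset (Fin s)), HasSubgaussianMGF (fun ω : Fin s → Cube d =>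
      -φ (ω j) - -ftplMean O η qs φ) ((‖(0 : ℝ) - -1‖₊ / 2) ^ 2)
      (Measure.pi fun _ : Fin s => μ) := by
    intro j _
    rw [← hmean j]
    refine hasSubgaussianMGF_of_mem_Icc (X := fun ω : Fin s → Cube d => -φ (ω j))
      (hφm.neg.comp (measurable_pi_apply j)).aemeasurable
      (Filter.Eventually.of_forall fun ω => ?_)
    have := hφ (ω j)
    exact ⟨by linarith [this.2], by linarith [this.1]⟩
  have hH := HasSubgaussianMGF.measure_sum_ge_le_of_iIndepFun hind hsub
    (ε := s * b) (by positivity)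
  have hset : {xs : Fin s → Cube d | queryValueDist φ (empirical xs) + b ≤ ftplMean O η qs φ}
      = {ω | s * b ≤ ∑ j, (-φ (ω j) - -ftplMean O η qs φ)} := by
    ext xs
    simp only [Set.mem_ofPred_eq, queryValueDist_empirical, Finset.sum_sub_distrib,
      Finset.sum_neg_distrib, Finset.sum_const, Finset.card_univ, Fintype.card_fin, nsmul_eq_mul]
    rw [div_add' _ _ _ hs'.ne', div_le_iff₀ hs']
    constructor <;> intro h <;> linarith
  rw [hset, ← ofReal_measureReal]
  refine ENNReal.ofReal_le_ofReal (hH.trans_eq ?_)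
  congr 1
  simp
  field_simp

/-- A round is good if the drawn query nearly maximizes the score and the samples represent all the
queries of the class. -/
def GoodRound {m : ℕ} (O : Oracle d) (Q : QueryClass d) (η : Set.Ioi (0 : ℝ)) (D : Dataset d n)
    (a b : ℝ) (qs : Fin m → Q.Elem) (r : (Fin s → Cube d) × Q.Elem) : Prop :=
  (∀ φ, score Q r.1 D φ ≤ score Q r.1 D r.2 + a) ∧
    ∀ φ : Q.Elem, ftplMean O η (fun i => (qs i).1) φ.1
      ≤ queryValueDist φ.1 (empirical r.1) + b

/-- The sampling bound is taken over all queries at once, because the query of the round is drawn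
after the samples and depends on them. -/
theorem roundStep_not_good {m : ℕ} (O : Oracle d) (η : Set.Ioi (0 : ℝ)) (hn : 0 < n) (hs : 0 < s)
    (ρ₀ : ℝ) (D : Dataset d n) {a b : ℝ} (ha : 0 ≤ a) (hb : 0 ≤ b) (qs : Fin m → Q.Elem) :
    (roundStep O Q η s ρ₀ D qs).toOuterMeasure {r | ¬GoodRound O Q η D a b qs r}
      ≤ ENNReal.ofReal (Q.card * Real.exp (-(2 * s * b ^ 2))
        + Q.card * Real.exp (-(√(2 * ρ₀) * a * n / 2))) := by
  rw [ENNReal.ofReal_add (by positivity) (by positivity)]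
  set E : Q.Elem → Set (Fin s → Cube d) := fun φ =>
    {xs | queryValueDist φ.1 (empirical xs) + b ≤ ftplMean O η (fun i => (qs i).1) φ.1}
  refine (toOuterMeasure_bind_le _ _ _ (⋃ φ, E φ) (c := ENNReal.ofReal (Q.card *
    Real.exp (-(√(2 * ρ₀) * a * n / 2)))) fun xs hxs => ?_).trans ?_
  · rw [PMF.toOuterMeasure_map_apply]
    refine le_trans (measure_mono fun q hq => ?_)
      (expMechanism_score_tail hn hs xs (Real.sqrt_nonneg _) ha D)
    by_contra hcon
    refine hq ⟨fun φ => ?_, fun φ => ?_⟩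
    · by_contra h
      exact hcon ⟨φ, not_le.mp h⟩
    · by_contra h
      exact hxs (Set.mem_iUnion.mpr ⟨φ, (not_le.mp h).le⟩)
  · gcongr
    calc _ ≤ ∑ φ, (dataPlayer O η s fun i => (qs i).1).toOuterMeasure (E φ) :=
          measure_iUnion_fintype_le _ _
      _ ≤ ∑ _φ : Q.Elem, ENNReal.ofReal (Real.exp (-(2 * s * b ^ 2))) :=
          Finset.sum_le_sum fun φ _ => dataPlayer_tail O η hs _ (Q.mem_Icc φ.1 φ.2) hb
      _ = _ := by
          have hcard : Fintype.card Q.Elem = Q.card := Fintype.card_coe _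
          rw [Finset.sum_const, Finset.card_univ, hcard, nsmul_eq_mul,
            ENNReal.ofReal_mul (by positivity), ENNReal.ofReal_natCast]

/-! ### Accumulation over the rounds -/

/-- The regret bound maintained along transcripts whose rounds are all good. -/
def RegretBound {t : ℕ} (Q : QueryClass d) (η : Set.Ioi (0 : ℝ)) (D : Dataset d n) (c : ℝ)
    (h : (Fin (t + 1) → Q.Elem) × (Fin t → Fin s → Cube d)) : Prop :=
  ∀ φ : Q.Elem, ∑ j, score Q (h.2 j) D φ
    ≤ ∑ i, queryValue (h.1 i).1 D - potential η (fun i => (h.1 i).1) + 1 + t * c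

/-- The chain for one round: the score of `φ` is within `a` of the score of the drawn query, whose
sample value is within `b` of its FTPL mean, and that mean is at least the increment of the
potential minus `d η`. -/
theorem regretBound_extend {t : ℕ} (O : Oracle d) (η : Set.Ioi (0 : ℝ)) (D : Dataset d n)
    {a b : ℝ} {h : (Fin (t + 1) → Q.Elem) × (Fin t → Fin s → Cube d)}
    (hh : RegretBound Q η D (a + b + d * η) h) {r : (Fin s → Cube d) × Q.Elem}
    (hr : GoodRound O Q η D a b h.1 r) :
    RegretBound Q η D (a + b + d * η) (extend Q (h, r)) := by
  intro φ
  have h1 := hh φ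
  have h2 := hr.1 φ
  have h3 := hr.2 r.2
  have h4 : potential η (fun i => ((Fin.snoc h.1 r.2 : Fin (t + 2) → Q.Elem) i).1)
      ≤ potential η (fun i => (h.1 i).1) + ftplMean O η (fun i => (h.1 i).1) r.2.1 + d * η :=
    potential_add_le O η (fun x => by rw [Fin.sum_univ_castSucc]; simp)
      (Q.mem_Icc r.2.1 r.2.2)
  have h5 : score Q r.1 D r.2 = queryValue r.2.1 D - queryValueDist r.2.1 (empirical r.1) := rfl
  simp only [extend]
  rw [Fin.sum_univ_castSucc, Fin.sum_univ_castSucc]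
  simp only [Fin.snoc_castSucc, Fin.snoc_last]
  push_cast
  linarith

theorem queryValue_nonneg {φ : Cube d → ℝ} (hφ : ∀ x, φ x ∈ Set.Icc (0 : ℝ) 1)
    (D : Dataset d n) : 0 ≤ queryValue φ D :=
  div_nonneg (Finset.sum_nonneg fun _ _ => (hφ _).1) (Nat.cast_nonneg n)

theorem rounds_not_regretBound (O : Oracle d) (η : Set.Ioi (0 : ℝ)) (hn : 0 < n) (hs : 0 < s)
    (ρ₀ : ℝ) (D : Dataset d n) {a b : ℝ} (ha : 0 ≤ a) (hb : 0 ≤ b) (t : ℕ) :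
    (rounds O Q η s ρ₀ D t).toOuterMeasure {h | ¬RegretBound Q η D (a + b + d * η) h}
      ≤ t * ENNReal.ofReal (Q.card * Real.exp (-(2 * s * b ^ 2))
        + Q.card * Real.exp (-(√(2 * ρ₀) * a * n / 2))) := by
  induction t with
  | zero =>
    rw [Nat.cast_zero, zero_mul, rounds, PMF.toOuterMeasure_map_apply]
    refine le_of_eq (measure_mono_null (t := ∅) (fun q hq => hq fun φ => ?_) (by simp))
    -- The initial query is charged to the `+ 1` of `RegretBound`: its potential is at most 1 and
    -- its value on `D` is nonnegative.
    have h1 := potential_le (d := d) η.2 (fun _ : Fin 1 => q.1)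
      fun _ x => (Q.mem_Icc q.1 q.2 x).2
    have h2 := queryValue_nonneg (Q.mem_Icc q.1 q.2) D
    simp only [Finset.univ_eq_empty, Finset.sum_empty, CharP.cast_eq_zero, zero_mul, add_zero]
    norm_num at h1 ⊢
    linarith
  | succ t ih =>
    rw [rounds_succ, PMF.toOuterMeasure_map_apply, Nat.cast_succ, add_mul, one_mul]
    refine (toOuterMeasure_bind_le _ _ _ _ fun h hh => ?_).trans (add_le_add_left ih _)
    rw [PMF.toOuterMeasure_map_apply]
    refine le_trans (measure_mono fun r hr => ?_)
      (roundStep_not_good O η hn hs ρ₀ D ha hb h.1)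
    exact fun hg => hr (regretBound_extend O η D (not_not.mp hh) hg)

/-! ### The error of the output -/

theorem queryValueDist_average {T : ℕ} (φ : Cube d → ℝ) (xs : Fin T → Fin s → Cube d) :
    queryValueDist φ (fun x => (∑ t, empirical (xs t) x) / T)
      = (∑ t, queryValueDist φ (empirical (xs t))) / T := by
  unfold queryValueDist
  simp only [div_mul_eq_mul_div, ← Finset.sum_div, Finset.sum_mul]
  rw [Finset.sum_comm]

/-- A lower deviation of `φ` is an upper deviation of `1 - φ`, which is also in the class. -/
theorem maxError_le_of_forall (hn : 0 < n) {w : Cube d → ℝ} (hw : ∑ x, w x = 1) (D : Dataset d n)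
    {e : ℝ} (h : ∀ φ : Q.Elem, queryValue φ.1 D - queryValueDist φ.1 w ≤ e) :
    maxError Q D w ≤ e := by
  refine ciSup_le fun φ => abs_le.mpr ⟨?_, h φ⟩
  have h1 := h ⟨_, Q.neg_mem φ.1 φ.2⟩
  have hn' : (n : ℝ) ≠ 0 := by exact_mod_cast hn.ne'
  have h2 : queryValue (fun x => 1 - φ.1 x) D = 1 - queryValue φ.1 D := by
    simp only [queryValue, Finset.sum_sub_distrib, Finset.sum_const, Finset.card_univ,
      Fintype.card_fin, nsmul_eq_mul, mul_one]
    field_simp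
  have h3 : queryValueDist (fun x => 1 - φ.1 x) w = 1 - queryValueDist φ.1 w := by
    simp only [queryValueDist, mul_sub, mul_one, Finset.sum_sub_distrib, hw]
  simp only [h2, h3] at h1
  linarith

theorem sum_average_empirical {T : ℕ} (hT : 0 < T) (hs : 0 < s) (xs : Fin T → Fin s → Cube d) :
    ∑ x, (∑ t, empirical (xs t) x) / T = 1 := by
  have h := queryValueDist_average (fun _ => 1) xs
  simp only [queryValueDist_const_empirical hs (φ := fun _ : Cube d => (1 : ℝ)) (fun _ => rfl)] at h
  have hT' : (T : ℝ) ≠ 0 := by exact_mod_cast hT.ne'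
  simpa [queryValueDist, hT'] using h

theorem maxError_le_of_score {T : ℕ} (hn : 0 < n) (hT : 0 < T) (hs : 0 < s) (D : Dataset d n)
    (xs : Fin T → Fin s → Cube d) {e : ℝ} (h : ∀ φ : Q.Elem, ∑ t, score Q (xs t) D φ ≤ T * e) :
    maxError Q D (fun x => (∑ t, empirical (xs t) x) / T) ≤ e := by
  refine maxError_le_of_forall hn (sum_average_empirical hT hs xs) D fun φ => ?_
  have hT' : (0 : ℝ) < T := by exact_mod_cast hT
  have h1 := h φ
  simp only [score, Finset.sum_sub_distrib, Finset.sum_const, Finset.card_univ,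
    Fintype.card_fin, nsmul_eq_mul] at h1
  rw [queryValueDist_average, sub_le_iff_le_add, ← sub_le_iff_le_add', le_div_iff₀ hT']
  linarith

theorem maxError_le_of_regretBound {T : ℕ} (hn : 0 < n) (hT : 0 < T) (hs : 0 < s)
    (η : Set.Ioi (0 : ℝ)) (D : Dataset d n) {c : ℝ}
    {h : (Fin (T + 1) → Q.Elem) × (Fin T → Fin s → Cube d)} (hh : RegretBound Q η D c h) :
    maxError Q D (fun x => (∑ t, empirical (h.2 t) x) / T) ≤ (d / η + 1) / T + c := by
  have hT' : (0 : ℝ) < T := by exact_mod_cast hT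
  have hn' : (0 : ℝ) < n := by exact_mod_cast hn
  refine maxError_le_of_score hn hT hs D _ fun φ => (hh φ).trans ?_
  -- The dataset is a mixture of single records, and the potential dominates the cumulative query
  -- value at each of them.
  have h1 : ∑ i, queryValue (h.1 i).1 D ≤ potential η (fun i => (h.1 i).1) + d / η := by
    unfold queryValue
    rw [← Finset.sum_div, Finset.sum_comm, div_le_iff₀ hn']
    calc _ ≤ ∑ _r : Fin n, (potential η (fun i => (h.1 i).1) + d / η) :=
          Finset.sum_le_sum fun r _ => sum_le_potential_add η.2 _ _
      _ = _ := by simp; ring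
  have h2 : (T : ℝ) * ((d / η + 1) / T + c) = d / η + 1 + T * c := by field_simp
  linarith

theorem le_toOuterMeasure_of_compl_le {A : Type*} (p : PMF A) (S : Set A) {β : ℝ} (hβ : 0 ≤ β)
    (h : p.toOuterMeasure Sᶜ ≤ ENNReal.ofReal β) : ENNReal.ofReal (1 - β) ≤ p.toOuterMeasure S := by
  rw [ENNReal.ofReal_sub _ hβ, ENNReal.ofReal_one, tsub_le_iff_right]
  calc 1 = p.toOuterMeasure Set.univ :=
        ((PMF.toOuterMeasure_apply_eq_one_iff p _).mpr (Set.subset_univ _)).symm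
    _ ≤ p.toOuterMeasure S + p.toOuterMeasure Sᶜ := by
        rw [← Set.union_compl_self S]
        exact measure_union_le _ _
    _ ≤ _ := by gcongr

theorem fem_accuracy (O : Oracle d) (η : Set.Ioi (0 : ℝ)) (hn : 0 < n) (hs : 0 < s) {T : ℕ}
    (hT : 0 < T) (ρ : ℝ) (D : Dataset d n) {a b β : ℝ} (ha : 0 ≤ a) (hb : 0 ≤ b) (hβ : 0 ≤ β)
    (hfail : T * (Q.card * Real.exp (-(2 * s * b ^ 2))
        + Q.card * Real.exp (-(√(2 * (ρ / T)) * a * n / 2))) ≤ β) :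
    ENNReal.ofReal (1 - β) ≤ (fem O Q ρ T η s D).toOuterMeasure
      {w | maxError Q D w ≤ (d / η + 1) / T + (a + b + d * η)} := by
  rw [fem, PMF.toOuterMeasure_map_apply]
  refine le_toOuterMeasure_of_compl_le _ _ hβ ?_
  refine le_trans (measure_mono fun h hh => ?_)
    ((rounds_not_regretBound O η hn hs (ρ / T) D ha hb T).trans ?_)
  · exact fun hg => hh (maxError_le_of_regretBound hn hT hs η D hg)
  · rw [← ENNReal.ofReal_natCast, ← ENNReal.ofReal_mul (Nat.cast_nonneg T)]
    exact ENNReal.ofReal_le_ofReal hfail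

end Accuracy

/-! ### Degenerate cases -/

section Degenerate

variable {d n : ℕ} {Q : QueryClass d}

/-- A bound valid for all possible samples needs no probabilistic argument. It serves both the
constant queries and the regime where the claimed error is at least 1. -/
theorem fem_accuracy_of_forall (O : Oracle d) (η : Set.Ioi (0 : ℝ)) (hn : 0 < n) {s T : ℕ}
    (hs : 0 < s) (hT : 0 < T) (ρ : ℝ) (D : Dataset d n) {e β : ℝ} (hβ : 0 ≤ β)
    (h : ∀ (xs : Fin s → Cube d) (φ : Q.Elem), score Q xs D φ ≤ e) :
    ENNReal.ofReal (1 - β) ≤ (fem O Q ρ T η s D).toOuterMeasure {w | maxError Q D w ≤ e} := by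
  rw [fem, PMF.toOuterMeasure_map_apply]
  refine le_toOuterMeasure_of_compl_le _ _ hβ ?_
  refine (measure_mono_null (t := ∅) (fun h' hh => ?_) (by simp)).trans_le bot_le
  refine hh ?_
  refine maxError_le_of_score hn hT hs D _ fun φ => ?_
  calc _ ≤ ∑ _t : Fin T, e := Finset.sum_le_sum fun t _ => h _ φ
    _ = T * e := by simp

theorem score_le_one {s : ℕ} (hn : 0 < n) (xs : Fin s → Cube d) (D : Dataset d n) (φ : Q.Elem) :
    score Q xs D φ ≤ 1 := by
  have hφ := Q.mem_Icc φ.1 φ.2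
  have hn' : (0 : ℝ) < n := by exact_mod_cast hn
  have h1 : queryValue φ.1 D ≤ 1 := by
    rw [queryValue, div_le_one hn']
    calc _ ≤ ∑ _i : Fin n, (1 : ℝ) := Finset.sum_le_sum fun i _ => (hφ _).2
      _ = n := by simp
  have h2 : 0 ≤ queryValueDist φ.1 (empirical xs) := by
    rw [queryValueDist_empirical]
    exact div_nonneg (Finset.sum_nonneg fun i _ => (hφ _).1) (Nat.cast_nonneg s)
  unfold score
  linarith

/-- A one-element class closed under negation consists of the constant `1 / 2`. -/
theorem exists_eq_const (hdeg : d = 0 ∨ Q.card = 1) (φ : Q.Elem) : ∃ k : ℝ, ∀ x, φ.1 x = k := by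
  rcases hdeg with rfl | hQ
  · exact ⟨φ.1 default, fun x => by rw [Subsingleton.elim x default]⟩
  · have h1 := Finset.card_le_one.mp hQ.le _ (Q.neg_mem φ.1 φ.2) _ φ.2
    refine ⟨1 / 2, fun x => ?_⟩
    have h3 : 1 - φ.1 x = φ.1 x := congrFun h1 x
    linarith

theorem fem_accuracy_of_degenerate (O : Oracle d) (η : Set.Ioi (0 : ℝ)) (hn : 0 < n) {s T : ℕ}
    (hs : 0 < s) (hT : 0 < T) (ρ : ℝ) (D : Dataset d n) {e β : ℝ} (hβ : 0 ≤ β)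
    (hdeg : d = 0 ∨ Q.card = 1) (he : 0 ≤ e) :
    ENNReal.ofReal (1 - β) ≤ (fem O Q ρ T η s D).toOuterMeasure {w | maxError Q D w ≤ e} := by
  refine fem_accuracy_of_forall O η hn hs hT ρ D hβ fun xs φ => ?_
  obtain ⟨k, hk⟩ := exists_eq_const hdeg φ
  rwa [score, queryValue_const hn hk, queryValueDist_const_empirical hs hk, sub_self]

end Degenerate

/-! ### The choice of the parameters -/

/-- The number of rounds. -/
noncomputable def numRounds (d n k : ℕ) (ρ β : ℝ) : ℕ+ :=
  Nat.succPNat ⌈d * (n * √ρ) / Real.log (k / β)⌉₊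

/-- The rate of the noise. -/
noncomputable def noiseRate (d n k : ℕ) (ρ β : ℝ) : Set.Ioi (0 : ℝ) :=
  ⟨1 / √(numRounds d n k ρ β : ℕ), by
    have : (0 : ℝ) < (numRounds d n k ρ β : ℕ) := by exact_mod_cast (numRounds d n k ρ β).pos
    exact Set.mem_Ioi.mpr (by positivity)⟩

/-- The number of samples per round. -/
noncomputable def numSamples (d n k : ℕ) (ρ β : ℝ) : ℕ+ :=
  Nat.succPNat ⌈Real.log (2 * (numRounds d n k ρ β : ℕ) * k / β)
    / (2 * (d * (noiseRate d n k ρ β : ℝ)) ^ 2)⌉₊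

/-- Here `x` stands for `d` and `N` for `n √ρ`. At `T ≈ x N / L` both `x / √T` and `√T L / N` are of
order `√(x L / N)`; the term `log (2T)` causes the logarithmic factor. The slack 2 in `hT2` covers
the rounding up and the successor. -/
theorem round_error_le {x L N T : ℝ} (hx : 1 ≤ x) (hL : 1 / 2 ≤ L) (hN : x * L < N)
    (hT1 : x * N / L ≤ T) (hT2 : T ≤ x * N / L + 2) :
    4 * x / √T + √(2 * T) / N * (Real.log (2 * T) + L)
      ≤ 30 * (1 + Real.log (1 + N)) * √(x * L / N) := by
  have hL0 : 0 < L := by linarith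
  have hx0 : 0 < x := by linarith
  have hN0 : 0 < N := lt_trans (by positivity) hN
  set u := x * N / L
  set r := √(x * L / N)
  have hr : 0 ≤ r := Real.sqrt_nonneg _
  have hNL : x ≤ N / L := by rw [le_div_iff₀ hL0]; exact hN.le
  have hu_eq : u = x * (N / L) := mul_div_assoc _ _ _
  have hu1 : 1 ≤ u := by rw [hu_eq]; nlinarith
  have hT3 : T ≤ 3 * u := by linarith
  have hT0 : 0 < T := by linarith
  have hlog : 0 ≤ Real.log (1 + N) := Real.log_nonneg (by linarith)
  have h1 : 4 * x / √T ≤ 4 * r := by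
    have : x / √T ≤ r := by
      rw [← Real.sqrt_sq hx0.le, ← Real.sqrt_div (sq_nonneg x)]
      refine Real.sqrt_le_sqrt ?_
      calc x ^ 2 / T ≤ x ^ 2 / u := by gcongr
        _ = x * L / N := by simp only [u]; field_simp
    calc 4 * x / √T = 4 * (x / √T) := mul_div_assoc _ _ _
      _ ≤ 4 * r := by linarith
  -- From `T ≤ 3 u` one gets `2 T ≤ 6 u ≤ (5/2)² u`.
  have h2 : √(2 * T) / N ≤ 5 / 2 * r / L := by
    rw [div_le_iff₀ hN0, show 5 / 2 * r / L * N = 5 / 2 * (N / L) * r by ring]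
    refine Real.sqrt_le_iff.mpr ⟨by positivity, ?_⟩
    rw [mul_pow, Real.sq_sqrt (by positivity)]
    have : (5 / 2 * (N / L)) ^ 2 * (x * L / N) = 25 / 4 * u := by
      simp only [u]; field_simp; norm_num
    rw [this]
    linarith
  have h3 : Real.log (2 * T) ≤ 4 * (1 + Real.log (1 + N)) := by
    have hu4 : u ≤ 4 * N ^ 2 := by
      have hNL2 : N / L ≤ 2 * N := by rw [div_le_iff₀ hL0]; nlinarith
      calc u = x * (N / L) := hu_eq
        _ ≤ (2 * N) * (2 * N) := by gcongr; linarith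
        _ = 4 * N ^ 2 := by ring
    have hexp : (24 : ℝ) ≤ Real.exp 4 := by
      have h := Real.exp_one_gt_d9
      calc (24 : ℝ) ≤ 2.7 ^ 4 := by norm_num
        _ ≤ Real.exp 1 ^ 4 := by gcongr; linarith
        _ = Real.exp 4 := by rw [← Real.exp_nat_mul]; norm_num
    calc Real.log (2 * T) ≤ Real.log (Real.exp 4 * (1 + N) ^ 2) := by
          refine Real.log_le_log (by positivity) ?_
          calc 2 * T ≤ 24 * N ^ 2 := by linarith
            _ ≤ Real.exp 4 * (1 + N) ^ 2 := by gcongr; linarith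
      _ = 4 + 2 * Real.log (1 + N) := by
          rw [Real.log_mul (by positivity) (by positivity), Real.log_exp, Real.log_pow]
          norm_num
      _ ≤ _ := by linarith
  -- The hypothesis `L ≥ 1 / 2` gives `4 ≤ 8 L`, and the remaining `L` makes 9. The final constant
  -- is `4 + 45 / 2 ≤ 30`.
  have h4 : Real.log (2 * T) + L ≤ 9 * (1 + Real.log (1 + N)) * L := by nlinarith
  have h5 : √(2 * T) / N * (Real.log (2 * T) + L)
      ≤ 5 / 2 * r / L * (9 * (1 + Real.log (1 + N)) * L) := by
    have h6 : 0 ≤ Real.log (2 * T) + L := by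
      have := Real.log_nonneg (show (1 : ℝ) ≤ 2 * T by linarith)
      linarith
    gcongr
  have h7 : 5 / 2 * r / L * (9 * (1 + Real.log (1 + N)) * L)
      = 45 / 2 * (1 + Real.log (1 + N)) * r := by field_simp; ring
  nlinarith [mul_nonneg hr hlog]

/-- The values `a = √(2T) / (n √ρ) * log (2T|Q|/β)` and `b = d η` make each of the two failure
probabilities of a round at most `β / (2T)`. The number of samples is chosen so that the sampling
error is no larger than the stability term `d η`. -/
theorem fem_accuracy_of_parameters {d n : ℕ} {Q : QueryClass d} (O : Oracle d) (hd : 0 < d)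
    (hn : 0 < n) (D : Dataset d n) {ρ β : ℝ} (hρ : 0 < ρ) (hβ : 0 < β) (hβ1 : β < 1)
    {e : ℝ} (he : 4 * d / √(numRounds d n Q.card ρ β : ℕ)
      + √(2 * (numRounds d n Q.card ρ β : ℕ)) / (n * √ρ)
        * Real.log (2 * (numRounds d n Q.card ρ β : ℕ) * Q.card / β) ≤ e) :
    ENNReal.ofReal (1 - β) ≤ (fem O Q ρ (numRounds d n Q.card ρ β) (noiseRate d n Q.card ρ β)
      (numSamples d n Q.card ρ β) D).toOuterMeasure {w | maxError Q D w ≤ e} := by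
  have hηdef : (noiseRate d n Q.card ρ β : ℝ) = 1 / √(numRounds d n Q.card ρ β : ℕ) := rfl
  have hsdef : ((numSamples d n Q.card ρ β : ℕ) : ℝ)
    = ⌈Real.log (2 * (numRounds d n Q.card ρ β : ℕ) * Q.card / β)
      / (2 * (d * (noiseRate d n Q.card ρ β : ℝ)) ^ 2)⌉₊ + 1 := by
    simp [numSamples]
  have hη := Set.mem_Ioi.mp (noiseRate d n Q.card ρ β).2
  have hTpos := (numRounds d n Q.card ρ β).pos
  have hspos := (numSamples d n Q.card ρ β).pos
  set T : ℕ := (numRounds d n Q.card ρ β : ℕ)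
  set s : ℕ := (numSamples d n Q.card ρ β : ℕ)
  set η := noiseRate d n Q.card ρ β
  have hT : (1 : ℝ) ≤ T := by exact_mod_cast hTpos
  have hk : (1 : ℝ) ≤ Q.card := by exact_mod_cast Finset.card_pos.mpr Q.nonempty
  have hd' : (1 : ℝ) ≤ d := by exact_mod_cast hd
  have hn' : (0 : ℝ) < n := by exact_mod_cast hn
  have hM : 1 ≤ 2 * T * Q.card / β := by
    rw [le_div_iff₀ hβ]
    nlinarith
  have hlog : 0 ≤ Real.log (2 * T * Q.card / β) := Real.log_nonneg hM
  have hexp : Q.card * Real.exp (-Real.log (2 * T * Q.card / β)) = β / (2 * T) := by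
    rw [Real.exp_neg, Real.exp_log (by linarith)]
    field_simp
  have hb : 0 < d * (η : ℝ) := by positivity
  have h1 : Real.log (2 * T * Q.card / β) ≤ 2 * s * (d * (η : ℝ)) ^ 2 := by
    have h := (Nat.le_ceil (Real.log (2 * T * Q.card / β) / (2 * (d * (η : ℝ)) ^ 2))).trans
      (le_add_of_nonneg_right zero_le_one)
    rw [← hsdef, div_le_iff₀ (by positivity)] at h
    linarith
  have h2 : √(2 * (ρ / T)) * (√(2 * T) / (n * √ρ) * Real.log (2 * T * Q.card / β)) * n / 2
      = Real.log (2 * T * Q.card / β) := by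
    have h3 : √(2 * (ρ / T)) * √(2 * T) = 2 * √ρ := by
      rw [← Real.sqrt_mul (by positivity), show 2 * (ρ / T) * (2 * T) = 2 ^ 2 * ρ by
        field_simp, Real.sqrt_mul (by positivity), Real.sqrt_sq (by norm_num)]
    calc _ = √(2 * (ρ / T)) * √(2 * T) * (Real.log (2 * T * Q.card / β) * n / (2 * (n * √ρ))) := by
          ring
      _ = _ := by
          rw [h3]
          field_simp
  refine (fem_accuracy O η hn hspos hTpos ρ D
    (a := √(2 * T) / (n * √ρ) * Real.log (2 * T * Q.card / β)) (b := d * η)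
    (by positivity) hb.le hβ.le ?_).trans (measure_mono fun w hw => ?_)
  · rw [h2, hexp]
    have h3 : Q.card * Real.exp (-(2 * s * (d * (η : ℝ)) ^ 2)) ≤ β / (2 * T) := by
      rw [← hexp]
      gcongr
    calc _ ≤ T * (β / (2 * T) + β / (2 * T)) := by gcongr
      _ = β := by field_simp; ring
  · refine le_trans hw (le_trans ?_ he)
    have hsq : √(T : ℝ) * √T = T := Real.mul_self_sqrt (by positivity)
    have hsT : (1 : ℝ) ≤ √T := Real.one_le_sqrt.mpr hT
    -- Since `d / η = d √T ≥ 1`, the extra 1 at most doubles this term; together with `b` and the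
    -- stability term, each `d / √T`, the total is `4 d / √T`.
    have h4 : (d / (η : ℝ) + 1) / T ≤ 2 * d / √T := by
      rw [hηdef, div_le_div_iff₀ (by positivity) (by positivity)]
      simp only [div_div_eq_mul_div, div_one]
      nlinarith [mul_le_mul hd' hsT zero_le_one (by positivity)]
    have h5 : d * (η : ℝ) = d / √T := by rw [hηdef]; ring
    have h6 : 4 * d / √T = 2 * d / √T + d / √T + d / √(T : ℝ) := by ring
    rw [h5]
    linarith

theorem fem_accuracy_main {d n : ℕ} {Q : QueryClass d} (O : Oracle d) (hd : 0 < d)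
    (hQ : 2 ≤ Q.card) (hn : 0 < n) (D : Dataset d n) {ρ β : ℝ} (hρ : 0 < ρ) (hβ : 0 < β)
    (hβ1 : β < 1) {e : ℝ} (he : 30 * (1 + Real.log (1 + n * √ρ)) ^ 1 *
      ((d : ℝ) ^ (3 / 4 : ℝ) * √(Real.log (Q.card / β)) /
        (ρ ^ (1 / 4 : ℝ) * (n : ℝ) ^ (1 / 2 : ℝ))) ≤ e) :
    ENNReal.ofReal (1 - β) ≤ (fem O Q ρ (numRounds d n Q.card ρ β) (noiseRate d n Q.card ρ β)
      (numSamples d n Q.card ρ β) D).toOuterMeasure {w | maxError Q D w ≤ e} := by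
  have hn' : (0 : ℝ) < n := by exact_mod_cast hn
  have hd' : (1 : ℝ) ≤ d := by exact_mod_cast hd
  have hk : (2 : ℝ) ≤ Q.card := by exact_mod_cast hQ
  have hN0 : 0 < n * √ρ := by positivity
  set L := Real.log (Q.card / β) with hLdef
  have hL : 1 / 2 ≤ L := by
    have h1 : Real.log 2 ≤ L := by
      refine Real.log_le_log two_pos ?_
      rw [le_div_iff₀ hβ]
      nlinarith
    linarith [Real.log_two_gt_d9]
  -- The argument yields `d ^ (1/2)`; it is weakened to `d ^ (3/4)` using `d ≥ 1`.
  have hR : √(d * L / (n * √ρ)) ≤ (d : ℝ) ^ (3 / 4 : ℝ) * √L /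
      (ρ ^ (1 / 4 : ℝ) * (n : ℝ) ^ (1 / 2 : ℝ)) := by
    have h1 : √(d : ℝ) ≤ (d : ℝ) ^ (3 / 4 : ℝ) := by
      rw [Real.sqrt_eq_rpow]
      exact Real.rpow_le_rpow_of_exponent_le hd' (by norm_num)
    have h2 : √(n * √ρ) = ρ ^ (1 / 4 : ℝ) * (n : ℝ) ^ (1 / 2 : ℝ) := by
      rw [Real.sqrt_mul hn'.le, Real.sqrt_eq_rpow, Real.sqrt_eq_rpow, Real.sqrt_eq_rpow,
        ← Real.rpow_mul hρ.le, mul_comm]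
      norm_num
    rw [Real.sqrt_div (by positivity), Real.sqrt_mul (by positivity), h2]
    gcongr
  have hlog : 0 ≤ Real.log (1 + n * √ρ) := Real.log_nonneg (by linarith)
  have he' : 30 * (1 + Real.log (1 + n * √ρ)) * √(d * L / (n * √ρ)) ≤ e := by
    rw [pow_one] at he
    exact le_trans (by gcongr) he
  -- In this regime the claimed bound is at least 1, while scores never exceed 1.
  by_cases hbig : n * √ρ ≤ d * L
  · have h1 : 1 ≤ √(d * L / (n * √ρ)) := by
      rw [Real.one_le_sqrt, le_div_iff₀ hN0, one_mul]
      exact hbig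
    have h2 : 1 ≤ e := by nlinarith
    exact fem_accuracy_of_forall O _ hn (numSamples d n Q.card ρ β).pos
      (numRounds d n Q.card ρ β).pos ρ D hβ.le fun xs φ => (score_le_one hn xs D φ).trans h2
  · have hTdef : ((numRounds d n Q.card ρ β : ℕ) : ℝ) = ⌈d * (n * √ρ) / L⌉₊ + 1 := by
      simp [numRounds, hLdef]
    refine fem_accuracy_of_parameters O hd hn D hρ hβ hβ1 (le_trans ?_ he')
    have hTpos : (0 : ℝ) < (numRounds d n Q.card ρ β : ℕ) := by
      exact_mod_cast (numRounds d n Q.card ρ β).pos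
    set T : ℝ := ((numRounds d n Q.card ρ β : ℕ) : ℝ)
    have h1 : Real.log (2 * T * Q.card / β) = Real.log (2 * T) + L := by
      rw [mul_div_assoc, Real.log_mul (by positivity) (by positivity)]
    rw [h1]
    refine round_error_le hd' hL (not_le.mp hbig) ?_ ?_
    · rw [hTdef]
      exact (Nat.le_ceil _).trans (le_add_of_nonneg_right zero_le_one)
    · rw [hTdef]
      have := Nat.ceil_lt_add_one (show 0 ≤ d * (n * √ρ) / L by positivity)
      linarith

/-- Two comparisons carry the passage from `ρ` to `ε`: `log (k/β)` is at most a multiple of `log k *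
log (1/β)`, and `ε` is at most a multiple of `log (1/δ) √ρ`. Both need the logarithms bounded away
from 0, which is why the constant depends on `κ`. -/
theorem rate_le_rate {d n k : ℕ} (hk : 2 ≤ k) (hn : 0 < n) {κ ρ β δ ε : ℝ} (hκ0 : 0 < κ)
    (hκ : κ < 1) (hρ : 0 < ρ) (hβ : 0 < β) (hβκ : β ≤ κ) (hδ : 0 < δ) (hδκ : δ ≤ κ)
    (hε : ε = ρ + 2 * √(ρ * Real.log (1 / δ))) (hε1 : ε < 1) :
    30 * (1 + Real.log (1 + n * √ρ)) ^ 1 *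
      ((d : ℝ) ^ (3 / 4 : ℝ) * √(Real.log (k / β)) / (ρ ^ (1 / 4 : ℝ) * (n : ℝ) ^ (1 / 2 : ℝ)))
    ≤ 60 * √((1 / Real.log (1 / κ) + 2) * (2 / Real.log (1 / κ) + 1)) * (1 + Real.log n) ^ 1 *
      ((d : ℝ) ^ (3 / 4 : ℝ) * Real.log k ^ (1 / 2 : ℝ) *
        √(Real.log (1 / δ) * Real.log (1 / β)) / (ε ^ (1 / 2 : ℝ) * (n : ℝ) ^ (1 / 2 : ℝ))) := by
  have hn' : (1 : ℝ) ≤ n := by exact_mod_cast hn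
  have hk' : (2 : ℝ) ≤ k := by exact_mod_cast hk
  have hK : 0 < Real.log (1 / κ) := Real.log_pos (by rw [lt_div_iff₀ hκ0]; linarith)
  have hKδ : Real.log (1 / κ) ≤ Real.log (1 / δ) :=
    Real.log_le_log (by positivity) (by gcongr)
  have hKβ : Real.log (1 / κ) ≤ Real.log (1 / β) :=
    Real.log_le_log (by positivity) (by gcongr)
  have hlk : 1 / 2 ≤ Real.log k := by
    have := Real.log_le_log two_pos hk'
    linarith [Real.log_two_gt_d9]
  have hsplit : Real.log (k / β) = Real.log k + Real.log (1 / β) := by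
    rw [← Real.log_mul (by positivity) (by positivity)]
    ring_nf
  rw [hsplit]
  set K := Real.log (1 / κ)
  set A := Real.log (1 / δ)
  set B := Real.log (1 / β)
  set l := Real.log k
  have hA : 0 < A := hK.trans_le hKδ
  have hB : 0 < B := hK.trans_le hKβ
  have hε0 : 0 < ε := by rw [hε]; positivity
  have hρ1 : ρ < 1 := by
    have : 0 ≤ √(ρ * A) := Real.sqrt_nonneg _
    linarith
  have hsρ : 0 < √ρ := Real.sqrt_pos.mpr hρ
  have hsρ1 : √ρ ≤ 1 := Real.sqrt_le_one.mpr hρ1.le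
  have hρs : ρ ≤ √ρ := by nlinarith [Real.mul_self_sqrt hρ.le]
  have h1 : l + B ≤ (1 / K + 2) * (l * B) := by
    have e1 : 1 ≤ B / K := (one_le_div hK).mpr hKβ
    have e2 : (1 / K + 2) * (l * B) = l * (B / K) + 2 * l * B := by ring
    nlinarith
  have h2 : ε ≤ (2 / K + 1) * A * √ρ := by
    have e1 : 1 ≤ A / K := (one_le_div hK).mpr hKδ
    -- With `ρ ≤ √ρ` this gives `ε ≤ (1 + 2 √A) √ρ ≤ (2 + A) √ρ`, and `1 ≤ A / K` absorbs the 2.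
    have e2 : 2 * √A ≤ 1 + A := by nlinarith [Real.mul_self_sqrt hA.le, sq_nonneg (√A - 1)]
    have e3 : (2 / K + 1) * A = A / K + A / K + A := by ring
    rw [hε, Real.sqrt_mul hρ.le, e3]
    nlinarith
  have h3 : 1 + Real.log (1 + n * √ρ) ≤ 2 * (1 + Real.log n) := by
    have e1 : Real.log (1 + n * √ρ) ≤ Real.log (2 * n) := by
      refine Real.log_le_log (by positivity) ?_
      nlinarith
    rw [Real.log_mul two_ne_zero (by positivity)] at e1
    have := Real.log_nonneg hn'
    linarith [Real.log_two_lt_d9]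
  have h4 : √(l + B) / ρ ^ (1 / 4 : ℝ)
      ≤ √((1 / K + 2) * (2 / K + 1)) * (l ^ (1 / 2 : ℝ) * √(A * B) / ε ^ (1 / 2 : ℝ)) := by
    have e1 : ρ ^ (1 / 4 : ℝ) = √√ρ := by
      rw [Real.sqrt_eq_rpow, Real.sqrt_eq_rpow, ← Real.rpow_mul hρ.le]
      norm_num
    rw [e1, ← Real.sqrt_eq_rpow, ← Real.sqrt_eq_rpow, ← Real.sqrt_mul (by positivity),
      ← Real.sqrt_div (by positivity), ← Real.sqrt_div (by positivity),
      ← Real.sqrt_mul (by positivity)]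
    refine Real.sqrt_le_sqrt ?_
    rw [mul_div_assoc', div_le_div_iff₀ hsρ hε0]
    calc (l + B) * ε ≤ ((1 / K + 2) * (l * B)) * ((2 / K + 1) * A * √ρ) := by gcongr
      _ = _ := by ring
  have hlogn : 0 ≤ Real.log n := Real.log_nonneg hn'
  rw [pow_one, pow_one]
  calc _ = 30 * (1 + Real.log (1 + n * √ρ)) *
        ((d : ℝ) ^ (3 / 4 : ℝ) * (√(l + B) / ρ ^ (1 / 4 : ℝ)) / (n : ℝ) ^ (1 / 2 : ℝ)) := by
        field_simp
    _ ≤ 30 * (2 * (1 + Real.log n)) * ((d : ℝ) ^ (3 / 4 : ℝ) *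
        (√((1 / K + 2) * (2 / K + 1)) * (l ^ (1 / 2 : ℝ) * √(A * B) / ε ^ (1 / 2 : ℝ))) /
          (n : ℝ) ^ (1 / 2 : ℝ)) := by
        gcongr
    _ = _ := by
        field_simp
        ring

end FEM

/-! ### The main theorem -/

open FEM in
theorem mainTheorem2 :
    -- Privacy
    (∀ (d n : ℕ) (O : Oracle d) (Q : QueryClass d) (T s : ℕ+) (η : Set.Ioi (0 : ℝ)) (ρ δ : ℝ),
      0 < n → 0 < ρ → 0 < δ → δ ≤ 1 →
      IsDP (fem (n := n) O Q ρ T η s) (ρ + 2 * √(ρ * Real.log (1 / δ))) δ) ∧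
    -- Accuracy: the parameters are chosen from `d`, `n`, `|Q|`, `ρ`, `β` only
    ∃ (T s : (d n k : ℕ) → (ρ β : ℝ) → ℕ+) (η : (d n k : ℕ) → (ρ β : ℝ) → Set.Ioi (0 : ℝ)) (c : ℕ),
      (∃ C : ℝ, 0 < C ∧
        ∀ (d n : ℕ) (O : Oracle d) (Q : QueryClass d) (D : Dataset d n) (ρ β : ℝ),
          0 < n → 0 < ρ → 0 < β → β < 1 →
          ENNReal.ofReal (1 - β) ≤
            (fem O Q ρ (T d n Q.card ρ β) (η d n Q.card ρ β) (s d n Q.card ρ β) D).toOuterMeasure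
              {w | maxError Q D w ≤
                C * (1 + Real.log (1 + n * √ρ)) ^ c *
                  ((d : ℝ) ^ (3 / 4 : ℝ) * √(Real.log (Q.card / β)) /
                    (ρ ^ (1 / 4 : ℝ) * (n : ℝ) ^ (1 / 2 : ℝ)))}) ∧
      (∀ κ : ℝ, 0 < κ → κ < 1 → ∃ C : ℝ, 0 < C ∧
        ∀ (d n : ℕ) (O : Oracle d) (Q : QueryClass d) (D : Dataset d n) (ρ β δ ε : ℝ),
          0 < n → 0 < ρ → 0 < β → β ≤ κ → 0 < δ → δ ≤ κ →
          ε = ρ + 2 * √(ρ * Real.log (1 / δ)) → ε < 1 →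
          ENNReal.ofReal (1 - β) ≤
            (fem O Q ρ (T d n Q.card ρ β) (η d n Q.card ρ β) (s d n Q.card ρ β) D).toOuterMeasure
              {w | maxError Q D w ≤
                C * (1 + Real.log n) ^ c *
                  ((d : ℝ) ^ (3 / 4 : ℝ) * Real.log Q.card ^ (1 / 2 : ℝ) *
                    √(Real.log (1 / δ) * Real.log (1 / β)) /
                    (ε ^ (1 / 2 : ℝ) * (n : ℝ) ^ (1 / 2 : ℝ)))}) := by
  refine ⟨fun d n O Q T s η ρ δ _ hρ hδ hδ1 => isDP_fem O Q T.pos s η hρ hδ hδ1,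
    numRounds, numSamples, noiseRate, 1, ⟨30, by norm_num, ?_⟩, fun κ hκ0 hκ => ?_⟩
  · intro d n O Q D ρ β hn hρ hβ hβ1
    -- The bound vanishes when `d = 0`, and for a single query `log (|Q| / β)` may fall below the `1
    -- / 2` that the main estimate requires.
    by_cases hdeg : d = 0 ∨ Q.card = 1
    · refine fem_accuracy_of_degenerate O _ hn (PNat.pos _) (PNat.pos _) ρ D hβ.le hdeg ?_
      have h1 : (1 : ℝ) ≤ n := by exact_mod_cast hn
      have h2 : 0 ≤ Real.log (1 + n * √ρ) := Real.log_nonneg (by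
        have : 0 ≤ n * √ρ := by positivity
        linarith)
      positivity
    · push Not at hdeg
      have hk : 0 < Q.card := Finset.card_pos.mpr Q.nonempty
      exact fem_accuracy_main O (Nat.pos_of_ne_zero hdeg.1) (by lia) hn D hρ hβ hβ1 le_rfl
  · have hK : 0 < Real.log (1 / κ) := Real.log_pos (by rw [lt_div_iff₀ hκ0]; linarith)
    refine ⟨60 * √((1 / Real.log (1 / κ) + 2) * (2 / Real.log (1 / κ) + 1)), by positivity, ?_⟩
    intro d n O Q D ρ β δ ε hn hρ hβ hβκ hδ hδκ hε hε1
    have hk : 0 < Q.card := Finset.card_pos.mpr Q.nonempty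
    -- Here the bound is zero in both degenerate cases, since `log |Q| = 0` for a single query; the
    -- actual error is zero as well.
    by_cases hdeg : d = 0 ∨ Q.card = 1
    · refine fem_accuracy_of_degenerate O _ hn (PNat.pos _) (PNat.pos _) ρ D hβ.le hdeg ?_
      have h1 : 0 ≤ Real.log n := Real.log_natCast_nonneg n
      have h2 : 0 ≤ Real.log Q.card := Real.log_natCast_nonneg _
      have h3 : 0 ≤ ε := by rw [hε]; positivity
      positivity
    · push Not at hdeg
      exact fem_accuracy_main O (Nat.pos_of_ne_zero hdeg.1) (by lia) hn D hρ hβ (by linarith)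
        (rate_le_rate (by lia) hn hκ0 hκ hρ hβ hβκ hδ hδκ hε hε1)
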